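/- Let $n\ge 1$, write points of $\mathbb R^n$ as $x=(x',x_n)\in\mathbb R^{n-1}\times\mathbb R$ (for $n=1$, $\mathbb R^{0}$ is a point of measure one), and let $-1<a<1$, $\lambda_+,\lambda_->0$. Let $D\subset\mathbb R^n$ be a bounded domain (open, connected, nonempty), and put $D^+=D\cap\{x_n>0\}$, $D'=D\cap\{x_n=0\}$ (identified with an open subset of $\mathbb R^{n-1}$), $(\partial D)^+=\partial D\cap\{x_n>0\}$. Assume that $\partial D\cap\{x_n=0\}$ has zero $(n-1)$-dimensional Lebesgue measure in $\{x_n=0\}$. Let $W^{1,2}(D^+,x_n^a)$ be the space of functions $u\in L^2(D^+,x_n^a\,dx)$ whose distributional gradient is in $L^2(D^+,x_n^a\,dx)$. For $u$ and $g$ functions on $D^+$, "$u=g$ on $(\partial D)^+$" means that $u-g$ is the limit in $W^{1,2}(D^+,x_n^a)$ of (restrictions of) functions in $C_c^\infty(\mathbb R^n)$ vanishing in a neighbourhood of $(\partial D)^+$. For $x'\in D'$ we write $u(x',0)=l$ if the mean of $|u-l|$ over $\{|y'-x'|<r,\ 0<y_n<r\}$ tends to $0$ as $r\to0^+$; this defines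 the trace of $u\in W^{1,2}(D^+,x_n^a)$ at almost every point of $D'$, and inequalities on $D'$ are understood almost everywhere. Put $$E_a(u)=\int_{D^+}|\nabla u|^2x_n^a\,dx,\qquad J_a(u)=E_a(u)+2\int_{D'}\bigl(\lambda_+u^++\lambda_-u^-\bigr)\,dx'\in[0,\infty],$$ where $u^\pm=\max\{\pm u,0\}$. Let $u$ be a minimizer of $J_a$ among all functions in $W^{1,2}(D^+,x_n^a)$ that equal $g$ on $(\partial D)^+$, with $J_a(u)<\infty$, and suppose that $u\ge0$ on $D'$. Then: 1. the function $v(x)=u(x)-\frac{\lambda_+}{1-a}x_n^{1-a}$ minimizes $E_a$ among all functions $w\in W^{1,2}(D^+,x_n^a)$ that satisfy $w=h$ on $(\partial D)^+$ and $w\ge 0$ on $D'$, where $h(x)=g(x)-\frac{\lambda_+}{1-a}x_n^{1-a}$, and $v$ itself is such a function; 2. $u(x',0)=v(x',0)$ for $x'\in D'$ (if one of the two values exists, then so does the other, and they are equal); 3. consequently $\Gamma^+_u=\Gamma_v$, where $\Gamma^+_u=\partial'\{x'\in D':u(x',0)>0\}\cap D'$ is the free boundary of the positive phase of $u$, $\Gamma_v=\partial'\{x'\in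 D':v(x',0)>0\}\cap D'$ is the free boundary of $v$ in the fractional obstacle problem with thin obstacle $0$, and $\partial'$ is the boundary in $\mathbb R^{n-1}$. -/

import Mathlib

open MeasureTheory Filter Set
open scoped Topology ENNReal ContDiff

noncomputable section

namespace TwoPhaseFrac

/-- Points `x = (x', x_n)` of `ℝⁿ = ℝⁿ⁻¹ × ℝ`, with `n = d + 1`.  Only the topology, the linear
structure and the Lebesgue measure of this product are used; Euclidean lengths of gradients are
computed by `normSq` below. -/
abbrev Pt (d : ℕ) : Type := EuclideanSpace ℝ (Fin d) × ℝ

/-- The Euclidean inner product of `ℝⁿ⁻¹ × ℝ`. -/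
def dot {d : ℕ} (p q : Pt d) : ℝ := inner ℝ p.1 q.1 + p.2 * q.2

/-- The square of the Euclidean length in `ℝⁿ⁻¹ × ℝ`. -/
def normSq {d : ℕ} (p : Pt d) : ℝ := ‖p.1‖ ^ 2 + p.2 ^ 2

/-- `D⁺ = D ∩ {x_n > 0}`. -/
def upper {d : ℕ} (D : Set (Pt d)) : Set (Pt d) := {x | x ∈ D ∧ 0 < x.2}

/-- `D' = D ∩ {x_n = 0}`, as a subset of the thin space `ℝⁿ⁻¹`. -/
def thin {d : ℕ} (D : Set (Pt d)) : Set (EuclideanSpace ℝ (Fin d)) := {x' | (x', (0 : ℝ)) ∈ D}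

/-- `(∂D)⁺ = ∂D ∩ {x_n > 0}`. -/
def upperBdry {d : ℕ} (D : Set (Pt d)) : Set (Pt d) := {x | x ∈ frontier D ∧ 0 < x.2}

/-- `G` is the distributional gradient of `u` in the open set `Ω`. -/
def IsWeakGrad {d : ℕ} (Ω : Set (Pt d)) (u : Pt d → ℝ) (G : Pt d → Pt d) : Prop :=
  LocallyIntegrableOn u Ω ∧ LocallyIntegrableOn G Ω ∧
    ∀ φ : Pt d → ℝ, ContDiff ℝ ∞ φ → HasCompactSupport φ → tsupport φ ⊆ Ω →
      ∀ e : Pt d, ∫ x in Ω, u x * fderiv ℝ φ x e = - ∫ x in Ω, dot (G x) e * φ x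

/-- The measure `x_nᵃ dx` on `D⁺`. -/
def weighted {d : ℕ} (a : ℝ) (D : Set (Pt d)) : Measure (Pt d) :=
  (volume.restrict (upper D)).withDensity (fun x => ENNReal.ofReal (x.2 ^ a))

/-- The weighted Sobolev space `W^{1,2}(D⁺, x_nᵃ)`: functions in `L²(D⁺, x_nᵃ)` whose distributional
gradient in `D⁺` is in `L²(D⁺, x_nᵃ)`. -/
def MemW12 {d : ℕ} (a : ℝ) (D : Set (Pt d)) (u : Pt d → ℝ) : Prop :=
  MemLp u 2 (weighted a D) ∧ ∃ G, IsWeakGrad (upper D) u G ∧ MemLp G 2 (weighted a D)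

/-- The energy `E_a(u) = ∫_{D⁺} |∇u|² x_nᵃ dx`.  The distributional gradient is unique up to null
sets, so the infimum runs over equal values; it is `∞` if there is no distributional gradient. -/
def energy {d : ℕ} (a : ℝ) (D : Set (Pt d)) (u : Pt d → ℝ) : ℝ≥0∞ :=
  ⨅ (G : Pt d → Pt d) (_ : IsWeakGrad (upper D) u G), ∫⁻ x, ENNReal.ofReal (normSq (G x)) ∂weighted a D

/-- `u` has the value `l` at the point `(x', 0)` of the thin space in the sense of traces: the mean
of `|u - l|` over the half-neighbourhood `{|y' - x'| < r, 0 < y_n < r}` tends to `0` with `r`. -/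
def HasThinValue {d : ℕ} (u : Pt d → ℝ) (x' : EuclideanSpace ℝ (Fin d)) (l : ℝ) : Prop :=
  Tendsto (fun r : ℝ => ⨍⁻ y in Metric.ball x' r ×ˢ Ioo (0 : ℝ) r, ‖u y - l‖ₑ ∂volume) (𝓝[>] 0) (𝓝 0)

/-- `T` is the trace of `u` on `D'` (determined up to null sets): `T x' = u(x', 0)` for almost every
`x' ∈ D'`. -/
def IsThinTrace {d : ℕ} (D : Set (Pt d)) (u : Pt d → ℝ) (T : EuclideanSpace ℝ (Fin d) → ℝ) : Prop :=
  AEStronglyMeasurable T (volume.restrict (thin D)) ∧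
    ∀ᵐ x' ∂volume.restrict (thin D), HasThinValue u x' (T x')

/-- `u ≥ ψ` on `D'` in the sense of traces. -/
def ThinGE {d : ℕ} (D : Set (Pt d)) (u : Pt d → ℝ) (ψ : EuclideanSpace ℝ (Fin d) → ℝ) : Prop :=
  ∀ᵐ x' ∂volume.restrict (thin D), ∃ l, HasThinValue u x' l ∧ ψ x' ≤ l

/-- The thin part `∫_{D'} (λ₊ u⁺ + λ₋ u⁻) dx'` of the functional.  The trace of `u` on `D'` is unique
up to null sets, so the infimum runs over equal values. -/
def thinEnergy {d : ℕ} (lp lm : ℝ) (D : Set (Pt d)) (u : Pt d → ℝ) : ℝ≥0∞ :=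
  ⨅ (T : EuclideanSpace ℝ (Fin d) → ℝ) (_ : IsThinTrace D u T),
    ∫⁻ x' in thin D, ENNReal.ofReal (lp * max (T x') 0 + lm * max (- T x') 0)

/-- `J_a(u) = ∫_{D⁺} |∇u|² x_nᵃ dx + 2 ∫_{D'} (λ₊ u⁺ + λ₋ u⁻) dx'`, with values in `[0, ∞]`. -/
def functionalJ {d : ℕ} (a lp lm : ℝ) (D : Set (Pt d)) (u : Pt d → ℝ) : ℝ≥0∞ :=
  energy a D u + 2 * thinEnergy lp lm D u

/-- `w ∈ W^{1,2}(D⁺, x_nᵃ)` vanishes on `(∂D)⁺`: it is a limit in `W^{1,2}(D⁺, x_nᵃ)` of smooth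
functions on `ℝⁿ` that vanish in a neighbourhood of `(∂D)⁺`. -/
def ZeroOnUpperBdry {d : ℕ} (a : ℝ) (D : Set (Pt d)) (w : Pt d → ℝ) : Prop :=
  MemW12 a D w ∧ ∀ ε : ℝ≥0∞, 0 < ε →
    ∃ φ : Pt d → ℝ, ContDiff ℝ ∞ φ ∧ HasCompactSupport φ ∧ Disjoint (tsupport φ) (upperBdry D) ∧
      (∫⁻ x, ENNReal.ofReal ((w x - φ x) ^ 2) ∂weighted a D) + energy a D (fun x => w x - φ x) < ε

/-- `u ∈ W^{1,2}(D⁺, x_nᵃ)` with `u = g` on `(∂D)⁺`. -/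
def Admissible {d : ℕ} (a : ℝ) (D : Set (Pt d)) (g u : Pt d → ℝ) : Prop :=
  MemW12 a D u ∧ ZeroOnUpperBdry a D (fun x => u x - g x)

/-- `u` minimizes `J_a` among the functions of `W^{1,2}(D⁺, x_nᵃ)` that equal `g` on `(∂D)⁺`, with a
finite minimum. -/
def IsMinimizerJ {d : ℕ} (a lp lm : ℝ) (D : Set (Pt d)) (g u : Pt d → ℝ) : Prop :=
  Admissible a D g u ∧ functionalJ a lp lm D u ≠ ⊤ ∧
    ∀ w, Admissible a D g w → functionalJ a lp lm D u ≤ functionalJ a lp lm D w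

/-- `v` minimizes `E_a` among the functions of `W^{1,2}(D⁺, x_nᵃ)` that equal `h` on `(∂D)⁺` and
are at least `ψ` on `D'`: the fractional obstacle problem with thin obstacle `ψ`. -/
def IsMinimizerObstacle {d : ℕ} (a : ℝ) (D : Set (Pt d)) (h : Pt d → ℝ)
    (ψ : EuclideanSpace ℝ (Fin d) → ℝ) (v : Pt d → ℝ) : Prop :=
  (Admissible a D h v ∧ ThinGE D v ψ) ∧
    ∀ w, Admissible a D h w → ThinGE D w ψ → energy a D v ≤ energy a D w

/-- `Γ_v = ∂'{v(·,0) > ψ} ∩ D'`, the free boundary of the thin obstacle problem. -/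
def obstacleFreeBdry {d : ℕ} (D : Set (Pt d)) (v : Pt d → ℝ)
    (ψ : EuclideanSpace ℝ (Fin d) → ℝ) : Set (EuclideanSpace ℝ (Fin d)) :=
  frontier {x' | x' ∈ thin D ∧ ∃ l, HasThinValue v x' l ∧ ψ x' < l} ∩ thin D

/-- `Γ⁺_u = ∂'Ω⁺_u ∩ D'` with `Ω⁺_u = {u > 0} ∩ D'`. -/
def gammaPlus {d : ℕ} (D : Set (Pt d)) (u : Pt d → ℝ) : Set (EuclideanSpace ℝ (Fin d)) :=
  frontier {x' | x' ∈ thin D ∧ ∃ l, HasThinValue u x' l ∧ 0 < l} ∩ thin D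

/-- Subtraction of the explicit profile: `x ↦ f(x) - λ₊ x_n^{1-a} / (1-a)`. -/
def shift {d : ℕ} (a lp : ℝ) (f : Pt d → ℝ) : Pt d → ℝ :=
  fun x => f x - lp / (1 - a) * x.2 ^ (1 - a)

end TwoPhaseFrac

end

/-! Write `p` for the profile `λ₊ x_n^{1-a} / (1-a)`. Its gradient is `λ₊ x_n^{-a} e_n`, so the
weight cancels in the cross term of the square: `E_a(w - p) = E_a(w) - 2 λ₊ ∫_{D⁺} ∂_n w + E_a(p)`
(`energy_shift`). If `u` and `w` agree on `(∂D)⁺`, integration by parts gives `∫_{D⁺} ∂_n (w - u) =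
-∫_{D'} (w - u)` (`Admissible.integral_trace_sub`). When both are nonnegative on `D'`, only the `λ₊`
term survives in `J_a`, hence `E_a(w - p) - E_a(u - p) = J_a(w) - J_a(u)`. A competitor for the
obstacle problem becomes one for `J_a` on adding `p`, and `p` does not affect thin values because it
is continuous and vanishes on `{x_n = 0}`.

The work lies in the integration by parts, since `∂D` has no regularity and traces are limits of
means over half-cylinders. For a smooth `φ` vanishing near `(∂D)⁺`, extension by zero and the
fundamental theorem of calculus on vertical rays give the identity (`setIntegral_normalDeriv_eq`)
and the layer bound `∫_{D ∩ {0 < x_n < r}} |φ| ≤ r ∫_{D⁺} |∂_n φ|`. By Cauchy-Schwarz, weighted `L²`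
approximation is `L¹` approximation, as `x_n^{-a}` is integrable. The layer bound passes to `z - φ`,
and Tonelli with Fatou turns it into a bound of the trace of `z - φ` in `L¹(D')`
(`lintegral_trace_le`). Both sides of the identity therefore pass to the limit
(`NormalApprox.integral_trace`). -/

noncomputable section

namespace TwoPhaseFrac

variable {d : ℕ}

/-! ### Half-cylinders and the calculus of thin values -/

/-- The half-cylinder `{|y' - x'| < r, 0 < y_n < r}`. -/
def halfCyl (x' : EuclideanSpace ℝ (Fin d)) (r : ℝ) : Set (Pt d) :=
  Metric.ball x' r ×ˢ Ioo (0 : ℝ) r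

theorem isOpen_halfCyl (x' : EuclideanSpace ℝ (Fin d)) (r : ℝ) : IsOpen (halfCyl x' r) :=
  Metric.isOpen_ball.prod isOpen_Ioo

theorem measurableSet_halfCyl (x' : EuclideanSpace ℝ (Fin d)) (r : ℝ) :
    MeasurableSet (halfCyl x' r) := (isOpen_halfCyl x' r).measurableSet

theorem volume_halfCyl (x' : EuclideanSpace ℝ (Fin d)) (r : ℝ) :
    volume (halfCyl x' r) =
      volume (Metric.ball (0 : EuclideanSpace ℝ (Fin d)) r) * ENNReal.ofReal r := by
  rw [halfCyl, Measure.volume_eq_prod, Measure.prod_prod, Real.volume_Ioo, sub_zero,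
    ← Measure.addHaar_ball_center volume x' r]

theorem volume_halfCyl_ne_top (x' : EuclideanSpace ℝ (Fin d)) (r : ℝ) :
    volume (halfCyl x' r) ≠ ⊤ := by
  rw [volume_halfCyl]
  exact ENNReal.mul_ne_top measure_ball_lt_top.ne ENNReal.ofReal_ne_top

theorem volume_halfCyl_ne_zero (x' : EuclideanSpace ℝ (Fin d)) {r : ℝ} (hr : 0 < r) :
    volume (halfCyl x' r) ≠ 0 := by
  rw [volume_halfCyl]
  exact mul_ne_zero (Metric.measure_ball_pos volume _ hr).ne' (by simpa using hr)

theorem setLAverage_add_right {f g : Pt d → ℝ≥0∞} {s : Set (Pt d)}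
    (hg : AEMeasurable g (volume.restrict s)) :
    ⨍⁻ y in s, (f y + g y) ∂volume = (⨍⁻ y in s, f y ∂volume) + ⨍⁻ y in s, g y ∂volume :=
  lintegral_add_right' _ (hg.smul_measure _)

theorem setLAverage_le_of_forall {f g : Pt d → ℝ≥0∞} {s : Set (Pt d)} (hs : MeasurableSet s)
    (h : ∀ y ∈ s, f y ≤ g y) : ⨍⁻ y in s, f y ∂volume ≤ ⨍⁻ y in s, g y ∂volume := by
  rw [setLAverage_eq, setLAverage_eq]
  exact ENNReal.div_le_div_right (setLIntegral_mono' hs h) _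

theorem eventually_halfCyl_subset {x' : EuclideanSpace ℝ (Fin d)} {s : Set (Pt d)}
    (hs : s ∈ 𝓝 (x', (0 : ℝ))) : ∀ᶠ r in 𝓝[>] (0 : ℝ), halfCyl x' r ⊆ s := by
  obtain ⟨ε, hε, hsub⟩ := Metric.mem_nhds_iff.1 hs
  filter_upwards [Ioo_mem_nhdsGT hε] with r hr y hy
  refine hsub ?_
  rw [Metric.mem_ball, Prod.dist_eq, max_lt_iff]
  refine ⟨(Metric.mem_ball.1 hy.1).trans hr.2, ?_⟩
  rw [Real.dist_eq, sub_zero, abs_of_pos hy.2.1]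
  exact hy.2.2.trans hr.2

theorem eventually_halfCyl_subset_upper {D : Set (Pt d)} (hD : IsOpen D)
    {x' : EuclideanSpace ℝ (Fin d)} (hx : x' ∈ thin D) :
    ∀ᶠ r in 𝓝[>] (0 : ℝ), halfCyl x' r ⊆ upper D := by
  filter_upwards [eventually_halfCyl_subset (hD.mem_nhds hx)] with r hr y hy
  exact ⟨hr hy, hy.2.1⟩

theorem hasThinValue_of_continuousAt {f : Pt d → ℝ} {x' : EuclideanSpace ℝ (Fin d)}
    (hf : ContinuousAt f (x', 0)) : HasThinValue f x' (f (x', 0)) := by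
  refine ENNReal.tendsto_nhds_zero.2 fun ε hε => ?_
  have h1 : Tendsto (fun y => ‖f y - f (x', 0)‖ₑ) (𝓝 (x', 0)) (𝓝 0) := by
    have := (hf.tendsto.sub_const (f (x', 0))).enorm
    simpa using this
  filter_upwards [eventually_halfCyl_subset (ENNReal.tendsto_nhds_zero.1 h1 ε hε),
    self_mem_nhdsWithin] with r hr hr0
  calc _ ≤ ⨍⁻ _ in halfCyl x' r, ε ∂(volume : Measure (Pt d)) :=
        setLAverage_le_of_forall (measurableSet_halfCyl x' r) fun y hy => hr hy
    _ = ε := setLAverage_const (volume_halfCyl_ne_zero x' hr0) (volume_halfCyl_ne_top x' r) _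

/-- The lower integral is additive once one summand is measurable, so nothing is asked of `u`.
Measurability is required only for small `r` because functions on `D⁺` are controlled only on
half-cylinders inside `D⁺`. -/
theorem HasThinValue.add {u v : Pt d → ℝ} {x' : EuclideanSpace ℝ (Fin d)} {l m : ℝ}
    (hu : HasThinValue u x' l) (hv : HasThinValue v x' m)
    (hmeas : ∀ᶠ r in 𝓝[>] (0 : ℝ), AEMeasurable v (volume.restrict (halfCyl x' r))) :
    HasThinValue (fun y => u y + v y) x' (l + m) := by
  have h := Tendsto.add hu hv
  rw [add_zero] at h
  refine tendsto_of_tendsto_of_tendsto_of_le_of_le' tendsto_const_nhds h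
    (Eventually.of_forall fun _ => zero_le) ?_
  filter_upwards [hmeas] with r hr
  refine le_of_le_of_eq (setLAverage_le_of_forall (measurableSet_halfCyl x' r) fun y _ => ?_)
    (setLAverage_add_right (hr.sub_const m).enorm)
  rw [add_sub_add_comm]
  exact enorm_add_le _ _

theorem HasThinValue.neg {u : Pt d → ℝ} {x' : EuclideanSpace ℝ (Fin d)} {l : ℝ}
    (hu : HasThinValue u x' l) : HasThinValue (fun y => - u y) x' (-l) := by
  refine hu.congr fun r => ?_
  congr with y
  rw [← enorm_neg]
  congr 1
  ring

theorem HasThinValue.sub {u v : Pt d → ℝ} {x' : EuclideanSpace ℝ (Fin d)} {l m : ℝ}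
    (hu : HasThinValue u x' l) (hv : HasThinValue v x' m)
    (hmeas : ∀ᶠ r in 𝓝[>] (0 : ℝ), AEMeasurable v (volume.restrict (halfCyl x' r))) :
    HasThinValue (fun y => u y - v y) x' (l - m) := by
  simpa only [sub_eq_add_neg] using hu.add hv.neg (hmeas.mono fun r hr => hr.neg)

/-- The size of a thin value is at most the lower limit of the means of the function. -/
theorem HasThinValue.enorm_le_liminf {u : Pt d → ℝ} {x' : EuclideanSpace ℝ (Fin d)} {l : ℝ}
    (hu : HasThinValue u x' l)
    (hmeas : ∀ᶠ r in 𝓝[>] (0 : ℝ), AEMeasurable u (volume.restrict (halfCyl x' r)))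
    {r : ℕ → ℝ} (hr : Tendsto r atTop (𝓝[>] 0)) :
    ‖l‖ₑ ≤ liminf (fun k => ⨍⁻ y in halfCyl x' (r k), ‖u y‖ₑ ∂volume) atTop := by
  -- By the triangle inequality, `‖l‖ₑ` minus the mean deviation is a lower bound for the mean of
  -- `‖u‖ₑ`, and it converges to `‖l‖ₑ`.
  have h0 : Tendsto (fun k => ‖l‖ₑ - ⨍⁻ y in halfCyl x' (r k), ‖u y - l‖ₑ ∂volume) atTop
      (𝓝 ‖l‖ₑ) := by
    have := ENNReal.Tendsto.sub (tendsto_const_nhds (x := ‖l‖ₑ) (f := atTop)) (hu.comp hr)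
      (Or.inl enorm_ne_top)
    rwa [tsub_zero] at this
  rw [← h0.liminf_eq]
  refine liminf_le_liminf ?_
  filter_upwards [hr.eventually hmeas, hr.eventually self_mem_nhdsWithin] with k hk hk0
  rw [tsub_le_iff_right, add_comm, ← setLAverage_add_right hk.enorm,
    ← setLAverage_const (volume_halfCyl_ne_zero x' hk0) (volume_halfCyl_ne_top x' _) ‖l‖ₑ]
  refine setLAverage_le_of_forall (measurableSet_halfCyl x' _) fun y _ => ?_
  calc ‖l‖ₑ = ‖u y - (u y - l)‖ₑ := by rw [sub_sub_cancel]
    _ ≤ ‖u y‖ₑ + ‖u y - l‖ₑ := enorm_sub_le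
    _ = _ := add_comm _ _

theorem tendsto_one_div_add_nhdsGT :
    Tendsto (fun k : ℕ => 1 / ((k : ℝ) + 1)) atTop (𝓝[>] 0) :=
  tendsto_nhdsWithin_iff.2 ⟨tendsto_one_div_add_atTop_nhds_zero_nat,
    Eventually.of_forall fun k => by simp only [mem_Ioi]; positivity⟩

theorem HasThinValue.unique {u : Pt d → ℝ} {x' : EuclideanSpace ℝ (Fin d)} {l m : ℝ}
    (hu : HasThinValue u x' l) (hv : HasThinValue u x' m)
    (hmeas : ∀ᶠ r in 𝓝[>] (0 : ℝ), AEMeasurable u (volume.restrict (halfCyl x' r))) : l = m := by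
  have h := (hu.sub hv hmeas).enorm_le_liminf (hmeas.mono fun r hr => hr.sub hr)
    tendsto_one_div_add_nhdsGT
  simp only [sub_self, enorm_zero, laverage_zero, liminf_const, nonpos_iff_eq_zero,
    enorm_eq_zero] at h
  exact sub_eq_zero.1 h

theorem eventually_aemeasurable_halfCyl {D : Set (Pt d)} (hD : IsOpen D) {u : Pt d → ℝ}
    (hu : AEMeasurable u (volume.restrict (upper D))) {x' : EuclideanSpace ℝ (Fin d)}
    (hx : x' ∈ thin D) :
    ∀ᶠ r in 𝓝[>] (0 : ℝ), AEMeasurable u (volume.restrict (halfCyl x' r)) := by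
  filter_upwards [eventually_halfCyl_subset_upper hD hx] with r hr using hu.mono_set hr

/-! ### The profile is invisible to thin values -/

/-- The profile `λ₊ x_n^{1-a} / (1-a)`. -/
def profile (d : ℕ) (a lp : ℝ) : Pt d → ℝ := fun x => lp / (1 - a) * x.2 ^ (1 - a)

theorem continuous_profile {a : ℝ} (ha : a < 1) (lp : ℝ) : Continuous (profile d a lp) :=
  continuous_const.mul ((Real.continuous_rpow_const (by linarith)).comp continuous_snd)

theorem hasThinValue_profile {a : ℝ} (ha : a < 1) (lp : ℝ) (x' : EuclideanSpace ℝ (Fin d)) :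
    HasThinValue (profile d a lp) x' 0 := by
  have h := hasThinValue_of_continuousAt (continuous_profile (d := d) ha lp).continuousAt (x' := x')
  simpa [profile, Real.zero_rpow (show 1 - a ≠ 0 by linarith)] using h

theorem shift_eq (a lp : ℝ) (f : Pt d → ℝ) : shift a lp f = fun x => f x - profile d a lp x := rfl

theorem hasThinValue_shift_iff {a : ℝ} (ha : a < 1) (lp : ℝ) (u : Pt d → ℝ)
    (x' : EuclideanSpace ℝ (Fin d)) (l : ℝ) :
    HasThinValue u x' l ↔ HasThinValue (shift a lp u) x' l := by
  have hp := hasThinValue_profile (d := d) ha lp x'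
  have hm : ∀ᶠ r in 𝓝[>] (0 : ℝ),
      AEMeasurable (profile d a lp) (volume.restrict (halfCyl x' r)) :=
    Eventually.of_forall fun r => (continuous_profile ha lp).measurable.aemeasurable
  constructor
  · intro h
    simpa [shift_eq] using h.sub hp hm
  · intro h
    simpa [shift_eq] using h.add hp hm

/-! ### Distributional derivatives and their uniqueness -/

instance isAddHaarMeasure_volume : (volume : Measure (Pt d)).IsAddHaarMeasure :=
  inferInstanceAs ((volume : Measure (EuclideanSpace ℝ (Fin d))).prod
    (volume : Measure ℝ)).IsAddHaarMeasure

/-- `q` is the distributional derivative of `u` in the direction `e` in the open set `Ω`. -/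
def IsWeakDeriv (Ω : Set (Pt d)) (e : Pt d) (u q : Pt d → ℝ) : Prop :=
  LocallyIntegrableOn u Ω ∧ LocallyIntegrableOn q Ω ∧
    ∀ φ : Pt d → ℝ, ContDiff ℝ ∞ φ → HasCompactSupport φ → tsupport φ ⊆ Ω →
      ∫ x in Ω, u x * fderiv ℝ φ x e = - ∫ x in Ω, q x * φ x

theorem integrable_mul_of_tsupport_subset {Ω : Set (Pt d)} {u ψ : Pt d → ℝ}
    (hu : LocallyIntegrableOn u Ω) (hψ : Continuous ψ) (hc : HasCompactSupport ψ)
    (hs : tsupport ψ ⊆ Ω) : Integrable (fun x => u x * ψ x) := by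
  have h : IntegrableOn (fun x => u x * ψ x) (tsupport ψ) :=
    (hu.integrableOn_compact_subset hs hc).mul_continuousOn hψ.continuousOn hc
  refine (integrableOn_iff_integrable_of_support_subset fun x hx => ?_).1 h
  exact subset_tsupport ψ fun h0 => hx (by simp [h0])

theorem setIntegral_mul_of_tsupport_subset {Ω : Set (Pt d)} (u : Pt d → ℝ) {ψ : Pt d → ℝ}
    (hs : tsupport ψ ⊆ Ω) : ∫ x in Ω, u x * ψ x = ∫ x, u x * ψ x :=
  setIntegral_eq_integral_of_forall_compl_eq_zero fun x hx => by
    rw [image_eq_zero_of_notMem_tsupport fun h => hx (hs h), mul_zero]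

theorem continuous_fderiv_apply_of_contDiff {φ : Pt d → ℝ} (hφ : ContDiff ℝ ∞ φ) (e : Pt d) :
    Continuous fun x => fderiv ℝ φ x e :=
  (hφ.continuous_fderiv (by simp)).clm_apply continuous_const

/-- A classical derivative is a distributional derivative. -/
theorem isWeakDeriv_of_differentiableAt {Ω : Set (Pt d)} (hΩ : IsOpen Ω) {e : Pt d} {f q : Pt d → ℝ}
    (hf : ∀ x ∈ Ω, DifferentiableAt ℝ f x) (hfq : ∀ x ∈ Ω, fderiv ℝ f x e = q x)
    (hq : ContinuousOn q Ω) : IsWeakDeriv Ω e f q := by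
  have hfl : LocallyIntegrableOn f Ω :=
    ContinuousOn.locallyIntegrableOn
      (fun x hx => (hf x hx).continuousAt.continuousWithinAt) hΩ.measurableSet
  have hql : LocallyIntegrableOn q Ω := hq.locallyIntegrableOn hΩ.measurableSet
  refine ⟨hfl, hql, fun φ hφ hc hs => ?_⟩
  have hs' := (tsupport_fderiv_apply_subset ℝ (f := φ) e).trans hs
  -- Outside `Ω` nothing is known of `fderiv ℝ f`, but there `φ` vanishes.
  have hqφ : ∀ x, fderiv ℝ f x e * φ x = q x * φ x := fun x => by
    by_cases hx : x ∈ Ω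
    · rw [hfq x hx]
    · rw [image_eq_zero_of_notMem_tsupport fun h => hx (hs h), mul_zero, mul_zero]
  rw [setIntegral_mul_of_tsupport_subset f hs', setIntegral_mul_of_tsupport_subset q hs,
    integral_mul_fderiv_eq_neg_fderiv_mul_of_integrable]
  · simp only [hqφ]
  · simp only [hqφ]
    exact integrable_mul_of_tsupport_subset hql hφ.continuous hc hs
  · exact integrable_mul_of_tsupport_subset hfl (continuous_fderiv_apply_of_contDiff hφ e)
      (hc.fderiv_apply ℝ e) hs'
  · exact integrable_mul_of_tsupport_subset hfl hφ.continuous hc hs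
  · exact fun x hx => hf x (hs hx)
  · exact fun x _ => hφ.differentiable (by simp) x

theorem IsWeakDeriv.sub {Ω : Set (Pt d)} {e : Pt d} {u v p q : Pt d → ℝ}
    (hu : IsWeakDeriv Ω e u p) (hv : IsWeakDeriv Ω e v q) :
    IsWeakDeriv Ω e (fun x => u x - v x) (fun x => p x - q x) := by
  refine ⟨hu.1.sub hv.1, hu.2.1.sub hv.2.1, fun φ hφ hc hs => ?_⟩
  have hs' := (tsupport_fderiv_apply_subset ℝ (f := φ) e).trans hs
  have hce := hc.fderiv_apply ℝ e
  have hφe := continuous_fderiv_apply_of_contDiff hφ e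
  simp only [sub_mul]
  rw [integral_sub (integrable_mul_of_tsupport_subset hu.1 hφe hce hs').integrableOn
      (integrable_mul_of_tsupport_subset hv.1 hφe hce hs').integrableOn,
    integral_sub (integrable_mul_of_tsupport_subset hu.2.1 hφ.continuous hc hs).integrableOn
      (integrable_mul_of_tsupport_subset hv.2.1 hφ.continuous hc hs).integrableOn,
    hu.2.2 φ hφ hc hs, hv.2.2 φ hφ hc hs]
  ring

/-- The difference `p - q` is a derivative of `0`, so the fundamental lemma of the calculus of
variations applies. -/
theorem IsWeakDeriv.ae_eq {Ω : Set (Pt d)} (hΩ : IsOpen Ω) {e : Pt d} {u p q : Pt d → ℝ}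
    (hp : IsWeakDeriv Ω e u p) (hq : IsWeakDeriv Ω e u q) :
    p =ᵐ[volume.restrict Ω] q := by
  have h := hp.sub hq
  have h0 := hΩ.ae_eq_zero_of_integral_contDiff_smul_eq_zero h.2.1 fun φ hφ hc hs => by
    have h1 := h.2.2 φ hφ hc hs
    simp only [sub_self, zero_mul, integral_zero] at h1
    rw [setIntegral_mul_of_tsupport_subset _ hs] at h1
    simpa only [smul_eq_mul, mul_comm] using (neg_eq_zero.1 h1.symm)
  rw [EventuallyEq, ae_restrict_iff' hΩ.measurableSet]
  filter_upwards [h0] with x hx hxΩ using sub_eq_zero.1 (hx hxΩ)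

theorem dot_sub_left (p q e : Pt d) : dot (p - q) e = dot p e - dot q e := by
  simp only [dot, Prod.fst_sub, Prod.snd_sub, inner_sub_left]
  ring

/-- The linear form `p ↦ dot p e`. -/
def dotCLM (e : Pt d) : Pt d →L[ℝ] ℝ :=
  (innerSL ℝ e.1).comp (ContinuousLinearMap.fst ℝ _ _) +
    e.2 • ContinuousLinearMap.snd ℝ (EuclideanSpace ℝ (Fin d)) ℝ

theorem dotCLM_apply (e p : Pt d) : dotCLM e p = dot p e := by
  simp [dotCLM, dot, real_inner_comm, mul_comm]

/-- Reduces gradients to scalar derivatives in fixed directions, where integration by parts and the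
fundamental lemma are available. -/
theorem IsWeakGrad.isWeakDeriv {Ω : Set (Pt d)} {u : Pt d → ℝ} {G : Pt d → Pt d}
    (h : IsWeakGrad Ω u G) (e : Pt d) : IsWeakDeriv Ω e u (fun x => dot (G x) e) := by
  refine ⟨h.1, ?_, fun φ hφ hc hs => h.2.2 φ hφ hc hs e⟩
  intro x hx
  obtain ⟨s, hs, hi⟩ := h.2.1 x hx
  refine ⟨s, hs, ?_⟩
  simpa only [dotCLM_apply, IntegrableOn] using ContinuousLinearMap.integrable_comp (dotCLM e) hi

theorem isWeakGrad_of_isWeakDeriv {Ω : Set (Pt d)} {u : Pt d → ℝ} {G : Pt d → Pt d}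
    (hu : LocallyIntegrableOn u Ω) (hG : LocallyIntegrableOn G Ω)
    (h : ∀ e, IsWeakDeriv Ω e u (fun x => dot (G x) e)) : IsWeakGrad Ω u G :=
  ⟨hu, hG, fun φ hφ hc hs e => (h e).2.2 φ hφ hc hs⟩

theorem IsWeakGrad.sub {Ω : Set (Pt d)} {u v : Pt d → ℝ} {G H : Pt d → Pt d}
    (hu : IsWeakGrad Ω u G) (hv : IsWeakGrad Ω v H) :
    IsWeakGrad Ω (fun x => u x - v x) (fun x => G x - H x) :=
  isWeakGrad_of_isWeakDeriv (hu.1.sub hv.1) (hu.2.1.sub hv.2.1) fun e => by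
    simpa only [dot_sub_left] using (hu.isWeakDeriv e).sub (hv.isWeakDeriv e)

theorem IsWeakGrad.ae_eq {Ω : Set (Pt d)} (hΩ : IsOpen Ω) {u : Pt d → ℝ} {G H : Pt d → Pt d}
    (hG : IsWeakGrad Ω u G) (hH : IsWeakGrad Ω u H) : G =ᵐ[volume.restrict Ω] H := by
  have h1 : ∀ i : Fin d, ∀ᵐ x ∂volume.restrict Ω,
      dot (G x) (EuclideanSpace.single i 1, 0) = dot (H x) (EuclideanSpace.single i 1, 0) :=
    fun i => (hG.isWeakDeriv _).ae_eq hΩ (hH.isWeakDeriv _)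
  filter_upwards [ae_all_iff.2 h1,
    (hG.isWeakDeriv (0, 1)).ae_eq hΩ (hH.isWeakDeriv (0, 1))] with x hx hx2
  refine Prod.ext (PiLp.ext fun i => ?_) ?_
  · simpa [dot, EuclideanSpace.inner_single_right] using hx i
  · simpa [dot] using hx2

/-! ### The profile's gradient, the energy and the weighted space -/

/-- The gradient of the profile. -/
def profileGrad (d : ℕ) (a lp : ℝ) : Pt d → Pt d := fun x => (0, lp * x.2 ^ (-a))

theorem hasFDerivAt_profile {a : ℝ} (ha : a < 1) (lp : ℝ) {x : Pt d} (hx : 0 < x.2) :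
    HasFDerivAt (profile d a lp)
      ((lp * x.2 ^ (-a)) • ContinuousLinearMap.snd ℝ (EuclideanSpace ℝ (Fin d)) ℝ) x := by
  have h1 : HasDerivAt (fun t : ℝ => lp / (1 - a) * t ^ (1 - a)) (lp * x.2 ^ (-a)) x.2 := by
    have h := (Real.hasDerivAt_rpow_const (x := x.2) (p := 1 - a) (Or.inl hx.ne')).const_mul
      (lp / (1 - a))
    convert! h using 1
    rw [show 1 - a - 1 = -a by ring, ← mul_assoc, div_mul_cancel₀ _ (by linarith)]
  have h2 : HasFDerivAt (fun x : Pt d => x.2)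
      (ContinuousLinearMap.snd ℝ (EuclideanSpace ℝ (Fin d)) ℝ) x := hasFDerivAt_snd
  exact h1.comp_hasFDerivAt x h2

theorem isWeakGrad_profile {a : ℝ} (ha : a < 1) (lp : ℝ) {Ω : Set (Pt d)} (hΩ : IsOpen Ω)
    (hpos : ∀ x ∈ Ω, 0 < x.2) : IsWeakGrad Ω (profile d a lp) (profileGrad d a lp) := by
  have hc : ContinuousOn (profileGrad d a lp) Ω :=
    continuousOn_const.prodMk (continuousOn_const.mul
      (continuous_snd.continuousOn.rpow_const fun x hx => Or.inl (hpos x hx).ne'))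
  refine isWeakGrad_of_isWeakDeriv
    ((continuous_profile ha lp).continuousOn.locallyIntegrableOn hΩ.measurableSet)
    (hc.locallyIntegrableOn hΩ.measurableSet) fun e => ?_
  refine isWeakDeriv_of_differentiableAt hΩ
    (fun x hx => (hasFDerivAt_profile ha lp (hpos x hx)).differentiableAt) (fun x hx => ?_) ?_
  · rw [(hasFDerivAt_profile ha lp (hpos x hx)).fderiv]
    simp [profileGrad, dot]
  · simpa only [dotCLM_apply, Function.comp_def] using (dotCLM e).continuous.comp_continuousOn hc

theorem isOpen_upper {D : Set (Pt d)} (hD : IsOpen D) : IsOpen (upper D) :=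
  hD.inter (isOpen_lt continuous_const continuous_snd)

theorem isOpen_thin {D : Set (Pt d)} (hD : IsOpen D) : IsOpen (thin D) :=
  hD.preimage (Continuous.prodMk_left (0 : ℝ))

theorem normSq_sub (p q : Pt d) : normSq (p - q) = normSq p - 2 * dot p q + normSq q := by
  simp only [normSq, dot, Prod.fst_sub, Prod.snd_sub, norm_sub_sq_real]
  ring

theorem normSq_nonneg (p : Pt d) : 0 ≤ normSq p := by unfold normSq; positivity

theorem energy_eq {a : ℝ} {D : Set (Pt d)} (hD : IsOpen D) {u : Pt d → ℝ} {G : Pt d → Pt d}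
    (hG : IsWeakGrad (upper D) u G) :
    energy a D u = ∫⁻ x, ENNReal.ofReal (normSq (G x)) ∂weighted a D := by
  refine le_antisymm (iInf₂_le G hG) (le_iInf₂ fun H hH => le_of_eq (lintegral_congr_ae ?_))
  refine (withDensity_absolutelyContinuous _ _).ae_le ?_
  filter_upwards [hG.ae_eq (isOpen_upper hD) hH] with x hx
  rw [hx]

theorem exists_upper_subset {D : Set (Pt d)} (hD : Bornology.IsBounded D) :
    ∃ R : ℝ, 0 < R ∧
      upper D ⊆ Metric.ball (0 : EuclideanSpace ℝ (Fin d)) R ×ˢ Ioo (0 : ℝ) R := by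
  obtain ⟨R, hR, hsub⟩ := hD.subset_ball_lt 0 0
  refine ⟨R, hR, fun x hx => ?_⟩
  have h := hsub hx.1
  rw [Metric.mem_ball, Prod.dist_eq, max_lt_iff] at h
  refine ⟨Metric.mem_ball.2 h.1, hx.2, ?_⟩
  have h2 := h.2
  rw [Real.dist_eq, Prod.snd_zero, sub_zero] at h2
  exact (le_abs_self _).trans_lt h2

theorem measurable_snd_rpow (s : ℝ) : Measurable fun x : Pt d => x.2 ^ s :=
  measurable_snd.pow_const s

/-- `D⁺` lies in a box, where the integral factors into the volume of a ball and `∫₀ᴿ tˢ dt`. -/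
theorem integrableOn_snd_rpow {D : Set (Pt d)} (hD : Bornology.IsBounded D) {s : ℝ}
    (hs : -1 < s) : IntegrableOn (fun x : Pt d => x.2 ^ s) (upper D) := by
  obtain ⟨R, hR, hsub⟩ := exists_upper_subset hD
  refine IntegrableOn.mono_set ?_ hsub
  have h1 : IntegrableOn (fun t : ℝ => t ^ s) (Ioo 0 R) := by
    have := intervalIntegral.intervalIntegrable_rpow' (a := 0) (b := R) hs
    rw [intervalIntegrable_iff_integrableOn_Ioc_of_le hR.le] at this
    exact this.mono_set Ioo_subset_Ioc_self
  have h2 : IntegrableOn (fun _ : EuclideanSpace ℝ (Fin d) => (1 : ℝ)) (Metric.ball 0 R) :=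
    integrableOn_const measure_ball_lt_top.ne
  have h3 := Integrable.mul_prod h2 h1
  rw [Measure.prod_restrict] at h3
  simp only [one_mul] at h3
  exact h3

theorem lintegral_weighted (a : ℝ) (D : Set (Pt d)) (f : Pt d → ℝ≥0∞) :
    ∫⁻ x, f x ∂weighted a D = ∫⁻ x in upper D, ENNReal.ofReal (x.2 ^ a) * f x :=
  lintegral_withDensity_eq_lintegral_mul_non_measurable _ (measurable_snd_rpow a).ennreal_ofReal
    (Eventually.of_forall fun _ => ENNReal.ofReal_lt_top) f

theorem ae_restrict_upper {D : Set (Pt d)} (hD : IsOpen D) :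
    ∀ᵐ x ∂volume.restrict (upper D), x ∈ upper D :=
  ae_restrict_mem (isOpen_upper hD).measurableSet

/-- The density is positive on `D⁺`, so the weighted measure has no further null sets. -/
theorem restrict_upper_absolutelyContinuous (a : ℝ) {D : Set (Pt d)} (hD : IsOpen D) :
    volume.restrict (upper D) ≪ weighted a D := by
  refine withDensity_absolutelyContinuous' (measurable_snd_rpow a).ennreal_ofReal.aemeasurable ?_
  filter_upwards [ae_restrict_upper hD] with x hx
  exact (ENNReal.ofReal_pos.2 (Real.rpow_pos_of_pos hx.2 _)).ne'

theorem weighted_absolutelyContinuous (a : ℝ) (D : Set (Pt d)) :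
    weighted a D ≪ volume.restrict (upper D) := withDensity_absolutelyContinuous _ _

theorem integrable_weighted_iff (a : ℝ) {D : Set (Pt d)} (hD : IsOpen D) {f : Pt d → ℝ} :
    Integrable f (weighted a D) ↔ IntegrableOn (fun x => x.2 ^ a * f x) (upper D) := by
  rw [weighted, integrable_withDensity_iff_integrable_smul'
    (measurable_snd_rpow a).ennreal_ofReal
    (Eventually.of_forall fun _ => ENNReal.ofReal_lt_top)]
  refine integrable_congr ?_
  filter_upwards [ae_restrict_upper hD] with x hx
  rw [ENNReal.toReal_ofReal (Real.rpow_nonneg hx.2.le _), smul_eq_mul]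

theorem integral_weighted (a : ℝ) {D : Set (Pt d)} (hD : IsOpen D) (f : Pt d → ℝ) :
    ∫ x, f x ∂weighted a D = ∫ x in upper D, x.2 ^ a * f x := by
  rw [weighted, integral_withDensity_eq_integral_toReal_smul
    (measurable_snd_rpow a).ennreal_ofReal
    (Eventually.of_forall fun _ => ENNReal.ofReal_lt_top)]
  refine integral_congr_ae ?_
  filter_upwards [ae_restrict_upper hD] with x hx
  rw [ENNReal.toReal_ofReal (Real.rpow_nonneg hx.2.le _), smul_eq_mul]

/-- The weight times the square of `x_nˢ` is `x_n^{a+2s}`. The profile uses `s = 1 - a` and its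
gradient `s = -a`, giving the exponents `2 - a` and `-a`, both above `-1`. -/
theorem memLp_snd_rpow {a s c : ℝ} {D : Set (Pt d)} (hD : IsOpen D)
    (hDb : Bornology.IsBounded D) (hs : -1 < a + 2 * s) :
    MemLp (fun x : Pt d => c * x.2 ^ s) 2 (weighted a D) := by
  rw [memLp_two_iff_integrable_sq
    ((measurable_snd_rpow s).const_mul c).aestronglyMeasurable, integrable_weighted_iff a hD]
  refine ((integrableOn_snd_rpow hDb hs).const_mul (c ^ 2)).congr ?_
  filter_upwards [ae_restrict_upper hD] with x hx
  rw [Real.rpow_add hx.2, two_mul s, Real.rpow_add hx.2]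
  ring

theorem memLp_profile {a : ℝ} (ha' : a < 1) (lp : ℝ) {D : Set (Pt d)} (hD : IsOpen D)
    (hDb : Bornology.IsBounded D) : MemLp (profile d a lp) 2 (weighted a D) :=
  memLp_snd_rpow hD hDb (by linarith)

theorem memLp_profileGrad_snd {a : ℝ} (ha' : a < 1) (lp : ℝ) {D : Set (Pt d)} (hD : IsOpen D)
    (hDb : Bornology.IsBounded D) :
    MemLp (fun x : Pt d => lp * x.2 ^ (-a)) 2 (weighted a D) :=
  memLp_snd_rpow hD hDb (by linarith)

theorem memLp_profileGrad {a : ℝ} (ha' : a < 1) (lp : ℝ) {D : Set (Pt d)} (hD : IsOpen D)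
    (hDb : Bornology.IsBounded D) : MemLp (profileGrad d a lp) 2 (weighted a D) := by
  refine (memLp_profileGrad_snd ha' lp hD hDb).of_le ?_ (Eventually.of_forall fun x => ?_)
  · exact (measurable_const.prodMk ((measurable_snd_rpow (-a)).const_mul lp)).aestronglyMeasurable
  · simpa [profileGrad, Prod.norm_def] using by positivity

theorem memW12_profile {a : ℝ} (ha' : a < 1) (lp : ℝ) {D : Set (Pt d)} (hD : IsOpen D)
    (hDb : Bornology.IsBounded D) : MemW12 a D (profile d a lp) :=
  ⟨memLp_profile ha' lp hD hDb, _,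
    isWeakGrad_profile ha' lp (isOpen_upper hD) fun _ hx => hx.2,
    memLp_profileGrad ha' lp hD hDb⟩

theorem MemW12.sub {a : ℝ} {D : Set (Pt d)} {u v : Pt d → ℝ} (hu : MemW12 a D u)
    (hv : MemW12 a D v) : MemW12 a D (fun x => u x - v x) := by
  obtain ⟨hu, G, hG, hG2⟩ := hu
  obtain ⟨hv, H, hH, hH2⟩ := hv
  exact ⟨hu.sub hv, _, hG.sub hH, hG2.sub hH2⟩

/-! ### From weighted `L²` to `L¹` approximation -/

/-- By the Cauchy-Schwarz inequality, the weighted `L²` norm controls the `L¹` norm. -/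
theorem exists_setLIntegral_enorm_le {a : ℝ} (ha' : a < 1) {D : Set (Pt d)} (hD : IsOpen D)
    (hDb : Bornology.IsBounded D) :
    ∃ C : ℝ≥0∞, C ≠ ⊤ ∧ ∀ f : Pt d → ℝ, AEMeasurable f (volume.restrict (upper D)) →
      ∫⁻ x in upper D, ‖f x‖ₑ ≤
        (∫⁻ x, ENNReal.ofReal (f x ^ 2) ∂weighted a D) ^ (1 / 2 : ℝ) * C := by
  have hi := integrableOn_snd_rpow hDb (s := -a) (by linarith)
  refine ⟨(∫⁻ x in upper D, ENNReal.ofReal (x.2 ^ (-a))) ^ (1 / 2 : ℝ),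
    ENNReal.rpow_ne_top_of_nonneg (by norm_num) ?_, fun f hf => ?_⟩
  · exact hi.lintegral_lt_top.ne
  -- Split `|f|` as `(x_n^{a/2} |f|) · x_n^{-a/2}`; the second factor contributes the constant.
  · have h := ENNReal.lintegral_mul_le_Lp_mul_Lq (volume.restrict (upper D))
      Real.HolderConjugate.two_two
      (f := fun x => ENNReal.ofReal (x.2 ^ (a / 2)) * ‖f x‖ₑ)
      (g := fun x => ENNReal.ofReal (x.2 ^ (-a / 2)))
      ((measurable_snd_rpow _).ennreal_ofReal.aemeasurable.mul hf.enorm)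
      (measurable_snd_rpow _).ennreal_ofReal.aemeasurable
    rw [lintegral_weighted]
    refine (le_of_eq ?_).trans (h.trans (le_of_eq ?_))
    · refine lintegral_congr_ae ?_
      filter_upwards [ae_restrict_upper hD] with x hx
      rw [Pi.mul_apply, mul_right_comm, ← ENNReal.ofReal_mul (Real.rpow_nonneg hx.2.le _),
        ← Real.rpow_add hx.2, show a / 2 + -a / 2 = 0 by ring, Real.rpow_zero,
        ENNReal.ofReal_one, one_mul]
    · congr 2
      · refine lintegral_congr_ae ?_
        filter_upwards [ae_restrict_upper hD] with x hx
        rw [ENNReal.mul_rpow_of_nonneg _ _ (by norm_num),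
          ENNReal.ofReal_rpow_of_nonneg (Real.rpow_nonneg hx.2.le _) (by norm_num),
          ← Real.rpow_mul hx.2.le, div_mul_cancel₀ _ (by norm_num), Real.enorm_eq_ofReal_abs,
          ENNReal.ofReal_rpow_of_nonneg (abs_nonneg _) (by norm_num), Real.rpow_two, sq_abs]
      · refine lintegral_congr_ae ?_
        filter_upwards [ae_restrict_upper hD] with x hx
        rw [ENNReal.ofReal_rpow_of_nonneg (Real.rpow_nonneg hx.2.le _) (by norm_num),
          ← Real.rpow_mul hx.2.le, div_mul_cancel₀ _ (by norm_num)]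

theorem aemeasurable_of_locallyIntegrableOn {Ω : Set (Pt d)} {u : Pt d → ℝ}
    (hu : LocallyIntegrableOn u Ω) : AEMeasurable u (volume.restrict Ω) :=
  hu.aestronglyMeasurable.aemeasurable

theorem integrableOn_upper_of_memLp {a : ℝ} (ha' : a < 1) {D : Set (Pt d)} (hD : IsOpen D)
    (hDb : Bornology.IsBounded D) {f : Pt d → ℝ} (hf : MemLp f 2 (weighted a D)) :
    IntegrableOn f (upper D) := by
  obtain ⟨C, hC, h⟩ := exists_setLIntegral_enorm_le ha' hD hDb
  have hm := hf.1.mono_ac (restrict_upper_absolutelyContinuous a hD)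
  refine ⟨hm, (h f hm.aemeasurable).trans_lt (ENNReal.mul_lt_top ?_ hC.lt_top)⟩
  exact ENNReal.rpow_lt_top_of_nonneg (by norm_num) hf.integrable_sq.lintegral_lt_top.ne

/-- A function vanishing on `(∂D)⁺` and its normal derivative are approximated in `L¹` by smooth
functions that vanish near `(∂D)⁺`. -/
theorem ZeroOnUpperBdry.exists_approx {a : ℝ} (ha' : a < 1) {D : Set (Pt d)} (hD : IsOpen D)
    (hDb : Bornology.IsBounded D) {w q : Pt d → ℝ} (hw : ZeroOnUpperBdry a D w)
    (hq : IsWeakDeriv (upper D) (0, 1) w q) {ε : ℝ≥0∞} (hε : 0 < ε) :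
    ∃ φ : Pt d → ℝ, ContDiff ℝ ∞ φ ∧ HasCompactSupport φ ∧
      Disjoint (tsupport φ) (upperBdry D) ∧ ∫⁻ x in upper D, ‖w x - φ x‖ₑ < ε ∧
      ∫⁻ x in upper D, ‖q x - fderiv ℝ φ x (0, 1)‖ₑ < ε := by
  obtain ⟨C, hC, h⟩ := exists_setLIntegral_enorm_le ha' hD hDb
  have hU := isOpen_upper hD
  obtain ⟨δ, hδ, hδ0⟩ : ∃ δ : ℝ≥0∞, δ ^ (1 / 2 : ℝ) * C < ε ∧ 0 < δ := by
    have ht : Tendsto (fun δ : ℝ≥0∞ => δ ^ (1 / 2 : ℝ) * C) (𝓝[>] 0) (𝓝 0) := by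
      have h1 : Tendsto (fun δ : ℝ≥0∞ => δ ^ (1 / 2 : ℝ)) (𝓝 0) (𝓝 0) := by
        have := (ENNReal.continuous_rpow_const (y := (1 / 2 : ℝ))).tendsto 0
        rwa [ENNReal.zero_rpow_of_pos (by norm_num)] at this
      have h2 := ENNReal.Tendsto.mul_const (b := C) h1 (Or.inr hC)
      rw [zero_mul] at h2
      exact h2.mono_left nhdsWithin_le_nhds
    exact ((ht.eventually (gt_mem_nhds hε)).and self_mem_nhdsWithin).exists
  obtain ⟨φ, hφ, hc, hdisj, hlt⟩ := hw.2 δ hδ0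
  have h1 := le_self_add.trans_lt hlt
  have h2 := le_add_self.trans_lt hlt
  -- Since the energy is an infimum, some gradient `H` of `w - φ` has energy below `δ`; its normal
  -- component is a.e. `q - ∂_n φ`.
  simp only [energy, iInf_lt_iff] at h2
  obtain ⟨H, hH, h2⟩ := h2
  have hφw : IsWeakDeriv (upper D) (0, 1) φ (fun x => fderiv ℝ φ x (0, 1)) :=
    isWeakDeriv_of_differentiableAt hU (fun x _ => hφ.differentiable (by simp) x) (fun _ _ => rfl)
      (continuous_fderiv_apply_of_contDiff hφ _).continuousOn
  have hqφ := hq.sub hφw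
  have hae := hqφ.ae_eq hU (hH.isWeakDeriv (0, 1))
  have key : ∀ s : ℝ≥0∞, s < δ → s ^ (1 / 2 : ℝ) * C < ε := fun s hs =>
    (mul_le_mul_left (ENNReal.rpow_le_rpow hs.le (by norm_num)) C).trans_lt hδ
  refine ⟨φ, hφ, hc, hdisj, ?_, ?_⟩
  · exact (h _ (aemeasurable_of_locallyIntegrableOn hqφ.1)).trans_lt (key _ h1)
  · refine (h _ (aemeasurable_of_locallyIntegrableOn hqφ.2.1)).trans_lt
      (key _ (lt_of_le_of_lt ?_ h2))
    refine lintegral_mono_ae ((weighted_absolutelyContinuous a D).ae_le ?_)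
    filter_upwards [hae] with x hx
    refine ENNReal.ofReal_le_ofReal ?_
    rw [hx]
    simp only [dot, normSq, inner_zero_right, mul_one, zero_add]
    linarith [sq_nonneg ‖(H x).1‖]

/-! ### Vertical slices of smooth functions vanishing near the upper boundary -/

theorem hasCompactSupport_slice_right {f : Pt d → ℝ} (hf : HasCompactSupport f)
    (y' : EuclideanSpace ℝ (Fin d)) : HasCompactSupport fun s : ℝ => f (y', s) :=
  HasCompactSupport.intro (hf.isCompact.image continuous_snd) fun s hs =>
    image_eq_zero_of_notMem_tsupport fun h => hs ⟨(y', s), h, rfl⟩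

theorem hasCompactSupport_slice_left {f : Pt d → ℝ} (hf : HasCompactSupport f) (t : ℝ) :
    HasCompactSupport fun y' : EuclideanSpace ℝ (Fin d) => f (y', t) :=
  HasCompactSupport.intro (hf.isCompact.image continuous_fst) fun y' hs =>
    image_eq_zero_of_notMem_tsupport fun h => hs ⟨(y', t), h, rfl⟩

/-- Extension by zero from `D` creates no jump: a frontier point of positive height has a
neighbourhood where `φ` vanishes, and any other point considered lies outside `closure D`. -/
theorem indicator_eventuallyEq_zero {D : Set (Pt d)} {φ : Pt d → ℝ} (hD : IsOpen D)
    (hdisj : Disjoint (tsupport φ) (upperBdry D)) {x : Pt d} (hx : x ∉ D)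
    (hx' : x ∉ frontier D ∨ 0 < x.2) : D.indicator φ =ᶠ[𝓝 x] fun _ => 0 := by
  by_cases hf : x ∈ frontier D
  · have h0 : x ∉ tsupport φ := fun h =>
      disjoint_left.1 hdisj h ⟨hf, hx'.resolve_left (not_not_intro hf)⟩
    filter_upwards [(isClosed_tsupport φ).isOpen_compl.mem_nhds h0] with y hy
    by_cases hyD : y ∈ D
    · rw [indicator_of_mem hyD, image_eq_zero_of_notMem_tsupport hy]
    · rw [indicator_of_notMem hyD]
  · have hcl : x ∉ closure D := fun h => hf ⟨h, by rwa [hD.interior_eq]⟩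
    filter_upwards [isClosed_closure.isOpen_compl.mem_nhds hcl] with y hy
    rw [indicator_of_notMem fun h => hy (subset_closure h)]

theorem hasDerivAt_indicator_slice {D : Set (Pt d)} {φ : Pt d → ℝ} (hD : IsOpen D)
    (hφ : ContDiff ℝ ∞ φ) (hdisj : Disjoint (tsupport φ) (upperBdry D))
    (y' : EuclideanSpace ℝ (Fin d)) {t : ℝ} (ht : (y', t) ∉ frontier D ∨ 0 < t) :
    HasDerivAt (fun s => D.indicator φ (y', s))
      (D.indicator (fun x => fderiv ℝ φ x (0, 1)) (y', t)) t := by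
  have hc : ContinuousAt (fun s : ℝ => (y', s)) t := (Continuous.prodMk_right y').continuousAt
  by_cases hx : (y', t) ∈ D
  · rw [indicator_of_mem hx]
    have h1 : HasDerivAt (fun s : ℝ => ((y', s) : Pt d)) (0, 1) t :=
      (hasDerivAt_const t y').prodMk (hasDerivAt_id t)
    refine (((hφ.differentiable (by simp)) (y', t)).hasFDerivAt.comp_hasDerivAt t
      h1).congr_of_eventuallyEq ?_
    filter_upwards [hc (hD.mem_nhds hx)] with s hs
    exact indicator_of_mem (show (y', s) ∈ D from hs) φ
  · rw [indicator_of_notMem hx]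
    exact (hasDerivAt_const t (0 : ℝ)).congr_of_eventuallyEq
      (hc.eventually (indicator_eventuallyEq_zero hD hdisj hx ht))

theorem integrable_indicator_slice {D : Set (Pt d)} (hD : IsOpen D) {f : Pt d → ℝ}
    (hf : Continuous f) (hc : HasCompactSupport f) (y' : EuclideanSpace ℝ (Fin d)) :
    Integrable fun s : ℝ => D.indicator f (y', s) :=
  ((hf.comp (Continuous.prodMk_right y')).integrable_of_hasCompactSupport
    (hasCompactSupport_slice_right hc y')).indicator
    (hD.preimage (Continuous.prodMk_right y')).measurableSet

/-- The fundamental theorem of calculus on a vertical ray, whose far end leaves the bounded set `D`.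
The ray may start at height `0` if its base point is off the frontier. -/
theorem setIntegral_Ioi_slice {D : Set (Pt d)} {φ : Pt d → ℝ} (hD : IsOpen D)
    (hDb : Bornology.IsBounded D) (hφ : ContDiff ℝ ∞ φ) (hc : HasCompactSupport φ)
    (hdisj : Disjoint (tsupport φ) (upperBdry D))
    (y' : EuclideanSpace ℝ (Fin d)) {t : ℝ} (ht0 : 0 ≤ t) (ht : (y', t) ∉ frontier D ∨ 0 < t) :
    ∫ s in Ioi t, D.indicator (fun x => fderiv ℝ φ x (0, 1)) (y', s) =
      - D.indicator φ (y', t) := by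
  rw [integral_Ioi_of_hasDerivAt_of_tendsto (f := fun s => D.indicator φ (y', s)) (m := 0),
    zero_sub]
  · exact (hasDerivAt_indicator_slice hD hφ hdisj y' ht).continuousAt.continuousWithinAt
  · exact fun s hs => hasDerivAt_indicator_slice hD hφ hdisj y' (Or.inr (ht0.trans_lt hs))
  · exact (integrable_indicator_slice hD (continuous_fderiv_apply_of_contDiff hφ _)
      (hc.fderiv_apply ℝ _) y').integrableOn
  · obtain ⟨R, hR, hsub⟩ := exists_upper_subset hDb
    refine tendsto_const_nhds.congr' ?_
    filter_upwards [eventually_ge_atTop R] with s hs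
    refine (indicator_of_notMem (fun h => ?_) _).symm
    exact absurd (hsub (show (y', s) ∈ upper D from ⟨h, hR.trans_le hs⟩)).2.2 (not_lt.2 hs)

theorem restrict_univ_prod (S : Set ℝ) :
    (volume : Measure (Pt d)).restrict (univ ×ˢ S) =
      (volume : Measure (EuclideanSpace ℝ (Fin d))).prod (volume.restrict S) := by
  rw [Measure.volume_eq_prod, ← Measure.prod_restrict, Measure.restrict_univ]

theorem setLIntegral_inter_univ_prod {D : Set (Pt d)} (hD : IsOpen D) (f : Pt d → ℝ≥0∞)
    (S : Set ℝ) :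
    ∫⁻ x in D ∩ univ ×ˢ S, f x = ∫⁻ x, D.indicator f x ∂
      (volume : Measure (EuclideanSpace ℝ (Fin d))).prod (volume.restrict S) := by
  rw [← restrict_univ_prod, setLIntegral_indicator hD.measurableSet]

theorem upper_eq_inter (D : Set (Pt d)) : upper D = D ∩ univ ×ˢ Ioi 0 := by
  ext x
  simp [upper]

theorem enorm_indicator_apply (D : Set (Pt d)) (f : Pt d → ℝ) (x : Pt d) :
    D.indicator (fun x => ‖f x‖ₑ) x = ‖D.indicator f x‖ₑ := by
  by_cases h : x ∈ D <;> simp [h]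

/-- The value at height `t` is minus the integral of `∂_n φ` above it; take absolute values and
integrate over `y'`. -/
theorem lintegral_slice_le {D : Set (Pt d)} {φ : Pt d → ℝ} (hD : IsOpen D)
    (hDb : Bornology.IsBounded D) (hφ : ContDiff ℝ ∞ φ) (hc : HasCompactSupport φ)
    (hdisj : Disjoint (tsupport φ) (upperBdry D)) {t : ℝ} (ht : 0 < t) :
    ∫⁻ y', ‖D.indicator φ (y', t)‖ₑ ≤ ∫⁻ x in upper D, ‖fderiv ℝ φ x (0, 1)‖ₑ := by
  have hm : Measurable fun x : Pt d => D.indicator (fun x => ‖fderiv ℝ φ x (0, 1)‖ₑ) x :=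
    (continuous_fderiv_apply_of_contDiff hφ _).measurable.enorm.indicator hD.measurableSet
  rw [upper_eq_inter, setLIntegral_inter_univ_prod hD, lintegral_prod _ hm.aemeasurable]
  refine lintegral_mono fun y' => ?_
  simp only [enorm_indicator_apply]
  rw [← enorm_neg, ← setIntegral_Ioi_slice hD hDb hφ hc hdisj y' ht.le (Or.inr ht)]
  exact (enorm_integral_le_lintegral_enorm _).trans
    (lintegral_mono_set (Ioi_subset_Ioi ht.le))

/-- The Poincaré inequality in a thin layer above `{x_n = 0}`. -/
theorem setLIntegral_layer_le {D : Set (Pt d)} {φ : Pt d → ℝ} (hD : IsOpen D)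
    (hDb : Bornology.IsBounded D) (hφ : ContDiff ℝ ∞ φ) (hc : HasCompactSupport φ)
    (hdisj : Disjoint (tsupport φ) (upperBdry D)) (r : ℝ) :
    ∫⁻ x in D ∩ univ ×ˢ Ioo 0 r, ‖φ x‖ₑ ≤
      ENNReal.ofReal r * ∫⁻ x in upper D, ‖fderiv ℝ φ x (0, 1)‖ₑ := by
  have hm : Measurable fun x : Pt d => D.indicator (fun x => ‖φ x‖ₑ) x :=
    hφ.continuous.measurable.enorm.indicator hD.measurableSet
  rw [setLIntegral_inter_univ_prod hD, lintegral_prod_symm _ hm.aemeasurable]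
  simp only [enorm_indicator_apply]
  calc _ ≤ ∫⁻ _ in Ioo 0 r, ∫⁻ x in upper D, ‖fderiv ℝ φ x (0, 1)‖ₑ :=
        setLIntegral_mono' measurableSet_Ioo fun t ht =>
          lintegral_slice_le hD hDb hφ hc hdisj ht.1
    _ = _ := by rw [setLIntegral_const, Real.volume_Ioo, sub_zero, mul_comm]

theorem integrableOn_thin_slice {φ : Pt d → ℝ} (hφ : Continuous φ) (hc : HasCompactSupport φ)
    (D : Set (Pt d)) : IntegrableOn (fun y' => φ (y', 0)) (thin D) :=
  ((hφ.comp (Continuous.prodMk_left (0 : ℝ))).integrable_of_hasCompactSupport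
    (hasCompactSupport_slice_left hc 0)).integrableOn

/-- Integration by parts in the normal direction for functions vanishing near `(∂D)⁺`. -/
theorem setIntegral_normalDeriv_eq {D : Set (Pt d)} {φ : Pt d → ℝ} (hD : IsOpen D)
    (hDb : Bornology.IsBounded D)
    (hDn : volume {x' : EuclideanSpace ℝ (Fin d) | (x', (0 : ℝ)) ∈ frontier D} = 0)
    (hφ : ContDiff ℝ ∞ φ) (hc : HasCompactSupport φ)
    (hdisj : Disjoint (tsupport φ) (upperBdry D)) :
    ∫ x in upper D, fderiv ℝ φ x (0, 1) = - ∫ y' in thin D, φ (y', 0) := by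
  have hi : Integrable (D.indicator fun x => fderiv ℝ φ x (0, 1))
      ((volume : Measure (EuclideanSpace ℝ (Fin d))).prod (volume.restrict (Ioi 0))) := by
    rw [← restrict_univ_prod]
    exact (((continuous_fderiv_apply_of_contDiff hφ _).integrable_of_hasCompactSupport
      (hc.fderiv_apply ℝ _)).indicator hD.measurableSet).integrableOn
  rw [upper_eq_inter, inter_comm, ← setIntegral_indicator hD.measurableSet, restrict_univ_prod,
    integral_prod _ hi, ← integral_neg, ← integral_indicator (isOpen_thin hD).measurableSet]
  refine integral_congr_ae ?_
  -- The null set assumption lets almost every ray start at height `0`.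
  filter_upwards [measure_eq_zero_iff_ae_notMem.1 hDn] with y' hy'
  rw [setIntegral_Ioi_slice hD hDb hφ hc hdisj y' le_rfl (Or.inl hy')]
  by_cases h : (y', (0 : ℝ)) ∈ D
  · rw [indicator_of_mem h, indicator_of_mem (show y' ∈ thin D from h)]
  · rw [indicator_of_notMem h, indicator_of_notMem (show y' ∉ thin D from h), neg_zero]

/-! ### Averages over half-cylinders and the trace bound -/

/-- The pairs of a point of the thin space and a point of its half-cylinder of radius `r`. -/
def cylRel (d : ℕ) (r : ℝ) : Set (EuclideanSpace ℝ (Fin d) × Pt d) :=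
  {p | p.2 ∈ halfCyl p.1 r}

theorem measurableSet_cylRel (r : ℝ) : MeasurableSet (cylRel d r) := by
  have h1 : IsOpen {p : EuclideanSpace ℝ (Fin d) × Pt d | dist p.2.1 p.1 < r} :=
    isOpen_lt (by fun_prop) continuous_const
  have h2 : IsOpen {p : EuclideanSpace ℝ (Fin d) × Pt d | p.2.2 ∈ Ioo 0 r} :=
    isOpen_Ioo.preimage (by fun_prop)
  exact (h1.inter h2).measurableSet

/-- Trades the domain moving with `x'` for a jointly measurable indicator, so that Tonelli's theorem
applies. -/
theorem setLIntegral_halfCyl_eq {F : Pt d → ℝ≥0∞} (hF : AEMeasurable F) (r : ℝ)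
    (x' : EuclideanSpace ℝ (Fin d)) : ∫⁻ y in halfCyl x' r, F y =
      ∫⁻ y, (cylRel d r).indicator (fun p => hF.mk F p.2) (x', y) := by
  rw [lintegral_congr_ae (ae_restrict_of_ae hF.ae_eq_mk),
    ← lintegral_indicator (measurableSet_halfCyl x' r)]
  rfl

theorem measurable_cylRel_indicator {F : Pt d → ℝ≥0∞} (hF : Measurable F) (r : ℝ) :
    Measurable ((cylRel d r).indicator fun p => F p.2) :=
  (hF.comp measurable_snd).indicator (measurableSet_cylRel r)

theorem measurable_setLIntegral_halfCyl {F : Pt d → ℝ≥0∞} (hF : AEMeasurable F) (r : ℝ) :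
    Measurable fun x' => ∫⁻ y in halfCyl x' r, F y := by
  simp only [setLIntegral_halfCyl_eq hF]
  exact (measurable_cylRel_indicator hF.measurable_mk r).lintegral_prod_right'

/-- Swap the integrals: for fixed `y` with `0 < y_n < r`, the admissible `x'` form a ball of radius
`r` about `y'`, whose volume does not depend on its centre. -/
theorem lintegral_setLIntegral_halfCyl {F : Pt d → ℝ≥0∞} (hF : AEMeasurable F) (r : ℝ) :
    ∫⁻ x', ∫⁻ y in halfCyl x' r, F y =
      volume (Metric.ball (0 : EuclideanSpace ℝ (Fin d)) r) * ∫⁻ y in univ ×ˢ Ioo 0 r, F y := by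
  simp only [setLIntegral_halfCyl_eq hF]
  rw [lintegral_congr_ae (ae_restrict_of_ae hF.ae_eq_mk), lintegral_lintegral_swap
    (f := fun x' y => (cylRel d r).indicator (fun p => hF.mk F p.2) (x', y))
    (measurable_cylRel_indicator hF.measurable_mk r).aemeasurable,
    ← lintegral_const_mul _ hF.measurable_mk,
    ← lintegral_indicator (MeasurableSet.univ.prod measurableSet_Ioo)]
  refine lintegral_congr fun y => ?_
  have h2 : ∀ x', (cylRel d r).indicator (fun p => hF.mk F p.2) (x', y) =
      (Metric.ball y.1 r).indicator (fun _ => (univ ×ˢ Ioo 0 r).indicator (hF.mk F) y) x' := by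
    intro x'
    simp [cylRel, halfCyl, indicator, dist_comm, ite_and]
  simp only [h2]
  rw [lintegral_indicator Metric.isOpen_ball.measurableSet, setLIntegral_const,
    Measure.addHaar_ball_center volume y.1 r]
  by_cases h3 : y ∈ (univ ×ˢ Ioo (0 : ℝ) r : Set (Pt d)) <;> simp [h3, mul_comm]

theorem lintegral_setLAverage_halfCyl {F : Pt d → ℝ≥0∞} (hF : AEMeasurable F) {r : ℝ}
    (hr : 0 < r) :
    ∫⁻ x', ⨍⁻ y in halfCyl x' r, F y ∂volume =
      (∫⁻ y in univ ×ˢ Ioo 0 r, F y) / ENNReal.ofReal r := by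
  simp only [setLAverage_eq, volume_halfCyl, div_eq_mul_inv]
  rw [lintegral_mul_const _ (measurable_setLIntegral_halfCyl hF r),
    lintegral_setLIntegral_halfCyl hF, ← div_eq_mul_inv, ← div_eq_mul_inv,
    ENNReal.mul_div_mul_left _ _ (Metric.measure_ball_pos volume _ hr).ne'
      measure_ball_lt_top.ne]

/-- If `z` is small in `L¹` of the layers `D ∩ {0 < x_n < r}`, relative to `r`, then so is its
trace. -/
theorem lintegral_trace_le {D : Set (Pt d)} (hD : IsOpen D) {z : Pt d → ℝ}
    {T : EuclideanSpace ℝ (Fin d) → ℝ} (hz : AEMeasurable z (volume.restrict (upper D)))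
    (hT : ∀ᵐ x' ∂volume.restrict (thin D), HasThinValue z x' (T x')) {δ : ℝ≥0∞}
    (hδ : ∀ r : ℝ, 0 < r → ∫⁻ x in D ∩ univ ×ˢ Ioo 0 r, ‖z x‖ₑ ≤ ENNReal.ofReal r * δ) :
    ∫⁻ x' in thin D, ‖T x'‖ₑ ≤ δ := by
  have hU := (isOpen_upper hD).measurableSet
  set F : Pt d → ℝ≥0∞ := (upper D).indicator fun x => ‖z x‖ₑ with hFdef
  have hF : AEMeasurable F := (aemeasurable_indicator_iff hU).2 hz.enorm
  set r : ℕ → ℝ := fun k => 1 / ((k : ℝ) + 1) with hrdef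
  have hr0 : ∀ k, 0 < r k := fun k => by simp only [hrdef]; positivity
  have hrt : Tendsto r atTop (𝓝[>] 0) := tendsto_one_div_add_nhdsGT
  have hM : ∀ k, Measurable fun x' => ⨍⁻ y in halfCyl x' (r k), F y ∂volume := fun k => by
    simp only [setLAverage_eq, volume_halfCyl]
    exact (measurable_setLIntegral_halfCyl hF _).div_const _
  have hle : ∀ᵐ x' ∂volume.restrict (thin D),
      ‖T x'‖ₑ ≤ liminf (fun k => ⨍⁻ y in halfCyl x' (r k), F y ∂volume) atTop := by
    filter_upwards [hT, ae_restrict_mem (isOpen_thin hD).measurableSet] with x' hx hxD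
    refine (hx.enorm_le_liminf (eventually_aemeasurable_halfCyl hD hz hxD) hrt).trans
      (le_of_eq (liminf_congr ?_))
    filter_upwards [hrt.eventually (eventually_halfCyl_subset_upper hD hxD)] with k hk
    refine setLAverage_congr_fun (measurableSet_halfCyl x' _) fun y hy => ?_
    simp only [hFdef, indicator_of_mem (hk hy)]
  -- Fatou's lemma; each averaged integral is a layer integral divided by `r`, hence at most `δ`.
  refine (lintegral_mono_ae hle).trans ((lintegral_liminf_le hM).trans ?_)
  refine (liminf_le_liminf (v := fun _ => δ) (Eventually.of_forall fun k => ?_)).trans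
    (liminf_const δ).le
  refine (setLIntegral_le_lintegral _ _).trans ?_
  rw [lintegral_setLAverage_halfCyl hF (hr0 k)]
  refine ENNReal.div_le_of_le_mul' (le_of_eq_of_le ?_ (hδ _ (hr0 k)))
  rw [hFdef, setLIntegral_indicator hU]
  congr 2
  ext x
  simp only [upper, mem_inter_iff, mem_ofPred_eq, mem_prod, mem_univ, true_and, mem_Ioo]
  tauto

theorem stronglyMeasurable_setIntegral_halfCyl {f : Pt d → ℝ} (hf : AEStronglyMeasurable f)
    (r : ℝ) : StronglyMeasurable fun x' => ∫ y in halfCyl x' r, f y := by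
  have h : ∀ x', ∫ y in halfCyl x' r, f y =
      ∫ y, (cylRel d r).indicator (fun p => hf.mk f p.2) (x', y) := fun x' => by
    rw [integral_congr_ae (ae_restrict_of_ae hf.ae_eq_mk),
      ← integral_indicator (measurableSet_halfCyl x' r)]
    rfl
  simp only [h]
  exact ((hf.stronglyMeasurable_mk.comp_measurable measurable_snd).indicator
    (measurableSet_cylRel r)).integral_prod_right'

theorem HasThinValue.tendsto_setAverage {u : Pt d → ℝ} {x' : EuclideanSpace ℝ (Fin d)} {l : ℝ}
    (hu : HasThinValue u x' l)
    (hi : ∀ᶠ r in 𝓝[>] (0 : ℝ), IntegrableOn u (halfCyl x' r)) :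
    Tendsto (fun r => ⨍ y in halfCyl x' r, u y) (𝓝[>] 0) (𝓝 l) := by
  rw [tendsto_iff_edist_tendsto_0]
  refine tendsto_of_tendsto_of_tendsto_of_le_of_le' tendsto_const_nhds hu
    (Eventually.of_forall fun _ => zero_le) ?_
  filter_upwards [hi, self_mem_nhdsWithin] with r hr hr0
  have hr0 : 0 < r := hr0
  have hne := volume_halfCyl_ne_zero x' hr0
  have hnt := volume_halfCyl_ne_top x' r
  have : ⨍ y in halfCyl x' r, u y - l = (⨍ y in halfCyl x' r, u y) - l := by
    rw [setAverage_eq, setAverage_eq, integral_sub hr (integrableOn_const hnt),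
      setIntegral_const, smul_sub, smul_smul, inv_mul_cancel₀, one_smul]
    exact ENNReal.toReal_ne_zero.2 ⟨hne, hnt⟩
  rw [edist_eq_enorm_sub, ← this]
  exact enorm_integral_le_lintegral_enorm _

/-- The trace of an integrable function is measurable. -/
theorem isThinTrace_of_hasThinValue {D : Set (Pt d)} (hD : IsOpen D) {u : Pt d → ℝ}
    (hu : IntegrableOn u (upper D)) {T : EuclideanSpace ℝ (Fin d) → ℝ}
    (hT : ∀ᵐ x' ∂volume.restrict (thin D), HasThinValue u x' (T x')) : IsThinTrace D u T := by
  have hU := (isOpen_upper hD).measurableSet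
  refine ⟨?_, hT⟩
  set f : Pt d → ℝ := (upper D).indicator u with hfdef
  have hf : AEStronglyMeasurable f := (hu.integrable_indicator hU).1
  -- The trace is an a.e. limit of means over half-cylinders, which are measurable in `x'`.
  refine aestronglyMeasurable_of_tendsto_ae atTop
    (f := fun (k : ℕ) x' => ⨍ y in halfCyl x' (1 / ((k : ℝ) + 1)), f y) (fun k => ?_) ?_
  · simp only [setAverage_eq, measureReal_def, volume_halfCyl]
    exact (StronglyMeasurable.const_smul (stronglyMeasurable_setIntegral_halfCyl hf _)
      (_ : ℝ)).aestronglyMeasurable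
  · filter_upwards [hT, ae_restrict_mem (isOpen_thin hD).measurableSet] with x' hx hxD
    have hsub := eventually_halfCyl_subset_upper hD hxD
    refine ((hx.tendsto_setAverage (hsub.mono fun r hr => hu.mono_set hr)).comp
      tendsto_one_div_add_nhdsGT).congr' ?_
    filter_upwards [tendsto_one_div_add_nhdsGT.eventually hsub] with k hk
    refine setAverage_congr_fun (measurableSet_halfCyl x' _)
      (Eventually.of_forall fun y hy => ?_)
    simp only [hfdef, indicator_of_mem (hk hy)]

/-! ### Integration by parts for limits of smooth functions -/

/-- `z` and its normal derivative `q` are approximated in `L¹` by smooth functions that vanish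
near `(∂D)⁺`. -/
def NormalApprox (D : Set (Pt d)) (z q : Pt d → ℝ) : Prop :=
  ∀ ε : ℝ≥0∞, 0 < ε → ∃ φ : Pt d → ℝ, ContDiff ℝ ∞ φ ∧ HasCompactSupport φ ∧
    Disjoint (tsupport φ) (upperBdry D) ∧ ∫⁻ x in upper D, ‖z x - φ x‖ₑ < ε ∧
    ∫⁻ x in upper D, ‖q x - fderiv ℝ φ x (0, 1)‖ₑ < ε


theorem lintegral_enorm_sub_sub_le {μ : Measure (Pt d)} {f g h k : Pt d → ℝ}
    (hf : AEMeasurable f μ) (hg : AEMeasurable g μ) :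
    ∫⁻ x, ‖(f x - h x) - (g x - k x)‖ₑ ∂μ ≤
      (∫⁻ x, ‖f x - g x‖ₑ ∂μ) + ∫⁻ x, ‖h x - k x‖ₑ ∂μ := by
  refine le_of_le_of_eq (lintegral_mono fun x => ?_) (lintegral_add_left' (hf.sub hg).enorm _)
  rw [sub_sub_sub_comm]
  exact enorm_sub_le

theorem fderiv_sub_apply_of_contDiff {φ χ : Pt d → ℝ} (hφ : ContDiff ℝ ∞ φ)
    (hχ : ContDiff ℝ ∞ χ) (x e : Pt d) :
    fderiv ℝ (fun x => φ x - χ x) x e = fderiv ℝ φ x e - fderiv ℝ χ x e := by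
  rw [fderiv_fun_sub (hφ.differentiable (by simp) x) (hχ.differentiable (by simp) x)]
  rfl

theorem disjoint_tsupport_sub {φ χ : Pt d → ℝ} {s : Set (Pt d)} (hφ : Disjoint (tsupport φ) s)
    (hχ : Disjoint (tsupport χ) s) : Disjoint (tsupport fun x => φ x - χ x) s := by
  refine (disjoint_union_left.2 ⟨hφ, hχ⟩).mono_left ?_
  exact tsupport_sub φ χ

/-- Boundary values are prescribed relative to `g`; this treats `w - u` as `(w - g) - (u - g)`. -/
theorem NormalApprox.sub {D : Set (Pt d)} {z w p q : Pt d → ℝ} (hz : NormalApprox D z p)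
    (hw : NormalApprox D w q) (hzm : AEMeasurable z (volume.restrict (upper D)))
    (hpm : AEMeasurable p (volume.restrict (upper D))) :
    NormalApprox D (fun x => z x - w x) (fun x => p x - q x) := by
  intro ε hε
  have hε2 : 0 < ε / 2 := ENNReal.half_pos hε.ne'
  obtain ⟨φ, hφ, hφc, hφd, h1, h2⟩ := hz _ hε2
  obtain ⟨χ, hχ, hχc, hχd, h3, h4⟩ := hw _ hε2
  refine ⟨fun x => φ x - χ x, hφ.sub hχ, hφc.sub hχc, disjoint_tsupport_sub hφd hχd, ?_, ?_⟩
  · refine (lintegral_enorm_sub_sub_le hzm hφ.continuous.measurable.aemeasurable).trans_lt ?_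
    rw [← ENNReal.add_halves ε]
    exact ENNReal.add_lt_add h1 h3
  · simp only [fderiv_sub_apply_of_contDiff hφ hχ]
    refine (lintegral_enorm_sub_sub_le hpm
      (continuous_fderiv_apply_of_contDiff hφ _).measurable.aemeasurable).trans_lt ?_
    rw [← ENNReal.add_halves ε]
    exact ENNReal.add_lt_add h2 h4

/-- The approximation inherits the Poincaré inequality in thin layers. -/
theorem NormalApprox.setLIntegral_layer_le {D : Set (Pt d)} (hD : IsOpen D)
    (hDb : Bornology.IsBounded D) {z q : Pt d → ℝ} (hz : NormalApprox D z q)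
    (hzm : AEMeasurable z (volume.restrict (upper D)))
    (hqm : AEMeasurable q (volume.restrict (upper D))) {φ : Pt d → ℝ} (hφ : ContDiff ℝ ∞ φ)
    (hc : HasCompactSupport φ) (hdisj : Disjoint (tsupport φ) (upperBdry D)) (r : ℝ) :
    ∫⁻ x in D ∩ univ ×ˢ Ioo 0 r, ‖z x - φ x‖ₑ ≤
      ENNReal.ofReal r * ∫⁻ x in upper D, ‖q x - fderiv ℝ φ x (0, 1)‖ₑ := by
  set δ := ∫⁻ x in upper D, ‖q x - fderiv ℝ φ x (0, 1)‖ₑ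
  have hsub : D ∩ univ ×ˢ Ioo 0 r ⊆ upper D := by
    rw [upper_eq_inter]
    exact inter_subset_inter_right _ (prod_mono_right Ioo_subset_Ioi_self)
  -- A second approximation `χ` of `z`, with error `η`, is inserted between `z` and `φ`. The smooth
  -- layer bound applies to `φ - χ`, and then `η → 0`.
  have hlim : Tendsto (fun η : ℝ≥0∞ => η + ENNReal.ofReal r * (η + δ)) (𝓝[>] 0)
      (𝓝 (0 + ENNReal.ofReal r * (0 + δ))) := by
    have h0 : Tendsto (fun η : ℝ≥0∞ => η) (𝓝[>] 0) (𝓝 0) := nhdsWithin_le_nhds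
    exact h0.add (ENNReal.Tendsto.const_mul (h0.add tendsto_const_nhds)
      (Or.inr ENNReal.ofReal_ne_top))
  rw [zero_add, zero_add] at hlim
  refine ge_of_tendsto hlim ?_
  filter_upwards [self_mem_nhdsWithin] with η hη
  obtain ⟨χ, hχ, hχc, hχd, h1, h2⟩ := hz η hη
  have hχ1 := continuous_fderiv_apply_of_contDiff hχ (0, 1)
  have hφ1 := continuous_fderiv_apply_of_contDiff hφ (0, 1)
  have h3 := TwoPhaseFrac.setLIntegral_layer_le hD hDb (hφ.sub hχ) (hc.sub hχc)
    (disjoint_tsupport_sub hdisj hχd) r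
  have h4 : ∫⁻ x in upper D, ‖fderiv ℝ (fun x => φ x - χ x) x (0, 1)‖ₑ ≤ η + δ := by
    calc _ = ∫⁻ x in upper D, ‖(q x - fderiv ℝ χ x (0, 1)) - (q x - fderiv ℝ φ x (0, 1))‖ₑ := by
          simp only [fderiv_sub_apply_of_contDiff hφ hχ, sub_sub_sub_cancel_left]
      _ ≤ ∫⁻ x in upper D, (‖q x - fderiv ℝ χ x (0, 1)‖ₑ + ‖q x - fderiv ℝ φ x (0, 1)‖ₑ) :=
          lintegral_mono fun x => enorm_sub_le
      _ = _ := lintegral_add_left' (hqm.sub hχ1.measurable.aemeasurable).enorm _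
      _ ≤ η + δ := add_le_add_left h2.le δ
  calc ∫⁻ x in D ∩ univ ×ˢ Ioo 0 r, ‖z x - φ x‖ₑ
      ≤ ∫⁻ x in D ∩ univ ×ˢ Ioo 0 r, (‖z x - χ x‖ₑ + ‖φ x - χ x‖ₑ) :=
        lintegral_mono fun x => by
          rw [← sub_sub_sub_cancel_right (z x) (φ x) (χ x)]
          exact enorm_sub_le
    _ = (∫⁻ x in D ∩ univ ×ˢ Ioo 0 r, ‖z x - χ x‖ₑ) +
          ∫⁻ x in D ∩ univ ×ˢ Ioo 0 r, ‖φ x - χ x‖ₑ :=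
        lintegral_add_left' ((hzm.mono_set hsub).sub
          hχ.continuous.measurable.aemeasurable).enorm _
    _ ≤ η + ENNReal.ofReal r * (η + δ) :=
        add_le_add ((lintegral_mono_set hsub).trans h1.le)
          (h3.trans (mul_le_mul_right h4 _))

/-- Integration by parts in the normal direction for functions vanishing on `(∂D)⁺`. -/
theorem NormalApprox.integral_trace {D : Set (Pt d)} (hD : IsOpen D)
    (hDb : Bornology.IsBounded D)
    (hDn : volume {x' : EuclideanSpace ℝ (Fin d) | (x', (0 : ℝ)) ∈ frontier D} = 0)
    {z q : Pt d → ℝ} (hz : NormalApprox D z q) (hzi : IntegrableOn z (upper D))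
    (hqi : IntegrableOn q (upper D)) {T : EuclideanSpace ℝ (Fin d) → ℝ}
    (hT : ∀ᵐ x' ∂volume.restrict (thin D), HasThinValue z x' (T x')) :
    IntegrableOn T (thin D) ∧ ∫ x' in thin D, T x' = - ∫ x in upper D, q x := by
  have hTm := (isThinTrace_of_hasThinValue hD hzi hT).1
  -- The layer bound makes the trace of `z - φ` as small in `L¹(D')` as `q - ∂_n φ` is in `L¹(D⁺)`.
  have hle : ∀ ε : ℝ≥0∞, 0 < ε → ∃ φ : Pt d → ℝ, ContDiff ℝ ∞ φ ∧ HasCompactSupport φ ∧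
      Disjoint (tsupport φ) (upperBdry D) ∧
      ∫⁻ x in upper D, ‖q x - fderiv ℝ φ x (0, 1)‖ₑ < ε ∧
      ∫⁻ x' in thin D, ‖T x' - φ (x', 0)‖ₑ < ε := by
    intro ε hε
    obtain ⟨φ, hφ, hc, hd, -, h2⟩ := hz ε hε
    refine ⟨φ, hφ, hc, hd, h2, (lintegral_trace_le hD (z := fun x => z x - φ x)
      (hzi.1.aemeasurable.sub hφ.continuous.measurable.aemeasurable) ?_ fun r _ =>
      hz.setLIntegral_layer_le hD hDb hzi.1.aemeasurable hqi.1.aemeasurable hφ hc hd r).trans_lt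
      h2⟩
    filter_upwards [hT] with x' hx
    exact hx.sub (hasThinValue_of_continuousAt hφ.continuous.continuousAt)
      (Eventually.of_forall fun r => hφ.continuous.measurable.aemeasurable)
  have hTi : IntegrableOn T (thin D) := by
    obtain ⟨φ, hφ, hc, -, -, h3⟩ := hle 1 one_pos
    have hφi := integrableOn_thin_slice hφ.continuous hc D
    have h4 : IntegrableOn (fun x' => T x' - φ (x', 0)) (thin D) :=
      ⟨hTm.sub hφi.1, h3.trans ENNReal.one_lt_top⟩
    exact (h4.add hφi).congr (Eventually.of_forall fun x' => sub_add_cancel _ _)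
  refine ⟨hTi, ?_⟩
  rw [← sub_eq_zero, sub_neg_eq_add, ← enorm_eq_zero, ← nonpos_iff_eq_zero]
  have hlim : Tendsto (fun η : ℝ≥0∞ => η + η) (𝓝[>] 0) (𝓝 (0 + 0)) :=
    Tendsto.add nhdsWithin_le_nhds nhdsWithin_le_nhds
  rw [add_zero] at hlim
  refine ge_of_tendsto hlim ?_
  filter_upwards [self_mem_nhdsWithin] with η hη
  obtain ⟨φ, hφ, hc, hd, h2, h3⟩ := hle η hη
  have hφ1 : IntegrableOn (fun x => fderiv ℝ φ x (0, 1)) (upper D) :=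
    ((continuous_fderiv_apply_of_contDiff hφ _).integrable_of_hasCompactSupport
      (hc.fderiv_apply ℝ _)).integrableOn
  have hs1 := integral_sub hTi (integrableOn_thin_slice hφ.continuous hc D)
  have hs2 := integral_sub hqi hφ1
  have hs3 := setIntegral_normalDeriv_eq hD hDb hDn hφ hc hd
  -- The identity is exact for `φ`, so its defect for `z` consists of the two approximation errors.
  have hs : (∫ x' in thin D, T x') + ∫ x in upper D, q x =
      (∫ x' in thin D, (T x' - φ (x', 0))) + ∫ x in upper D, (q x - fderiv ℝ φ x (0, 1)) := by
    rw [hs1, hs2, hs3]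
    ring
  rw [hs]
  exact (enorm_add_le _ _).trans (add_le_add
    ((enorm_integral_le_lintegral_enorm _).trans h3.le)
    ((enorm_integral_le_lintegral_enorm _).trans h2.le))

/-! ### Energies of shifted functions and comparison with `J_a` -/

theorem dot_normal (p : Pt d) : dot p (0, 1) = p.2 := by simp [dot]

theorem MemW12.shift {a : ℝ} (ha' : a < 1) (lp : ℝ) {D : Set (Pt d)} (hD : IsOpen D)
    (hDb : Bornology.IsBounded D) {u : Pt d → ℝ} (hu : MemW12 a D u) :
    MemW12 a D (shift a lp u) := hu.sub (memW12_profile ha' lp hD hDb)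

theorem Admissible.shift {a : ℝ} (ha' : a < 1) (lp : ℝ) {D : Set (Pt d)} (hD : IsOpen D)
    (hDb : Bornology.IsBounded D) {g u : Pt d → ℝ} (hu : Admissible a D g u) :
    Admissible a D (shift a lp g) (shift a lp u) := by
  refine ⟨hu.1.shift ha' lp hD hDb, ?_⟩
  have h : (fun x => TwoPhaseFrac.shift a lp u x - TwoPhaseFrac.shift a lp g x) =
      fun x => u x - g x := by
    funext x
    simp [shift_eq]
  rw [h]
  exact hu.2

theorem ThinGE.shift {a : ℝ} (ha' : a < 1) (lp : ℝ) {D : Set (Pt d)} {u : Pt d → ℝ}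
    {ψ : EuclideanSpace ℝ (Fin d) → ℝ} (hu : ThinGE D u ψ) :
    ThinGE D (TwoPhaseFrac.shift a lp u) ψ := by
  filter_upwards [hu] with x' ⟨l, hl, hle⟩
  exact ⟨l, (hasThinValue_shift_iff ha' lp u x' l).1 hl, hle⟩

theorem shift_shift_neg (a lp : ℝ) (u : Pt d → ℝ) : shift a lp (shift a (-lp) u) = u := by
  funext x
  simp only [shift]
  ring

theorem memLp_normal {a : ℝ} {D : Set (Pt d)} {G : Pt d → Pt d}
    (hG : MemLp G 2 (weighted a D)) : MemLp (fun x => (G x).2) 2 (weighted a D) :=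
  (ContinuousLinearMap.snd ℝ (EuclideanSpace ℝ (Fin d)) ℝ).comp_memLp' hG

theorem memLp_tangential {a : ℝ} {D : Set (Pt d)} {G : Pt d → Pt d}
    (hG : MemLp G 2 (weighted a D)) : MemLp (fun x => (G x).1) 2 (weighted a D) :=
  (ContinuousLinearMap.fst ℝ (EuclideanSpace ℝ (Fin d)) ℝ).comp_memLp' hG

theorem integrable_normSq {a : ℝ} {D : Set (Pt d)} {G : Pt d → Pt d}
    (hG : MemLp G 2 (weighted a D)) : Integrable (fun x => normSq (G x)) (weighted a D) :=
  ((memLp_two_iff_integrable_sq_norm (memLp_tangential hG).1).1 (memLp_tangential hG)).add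
    (memLp_normal hG).integrable_sq

theorem energy_eq_ofReal {a : ℝ} {D : Set (Pt d)} (hD : IsOpen D) {u : Pt d → ℝ}
    {G : Pt d → Pt d} (hG : IsWeakGrad (upper D) u G) (hG2 : MemLp G 2 (weighted a D)) :
    energy a D u = ENNReal.ofReal (∫ x, normSq (G x) ∂weighted a D) := by
  rw [energy_eq hD hG, ofReal_integral_eq_lintegral_ofReal (integrable_normSq hG2)
    (Eventually.of_forall fun x => normSq_nonneg _)]

/-- Expand the square: since `x_nᵃ x_n^{-a} = 1`, the cross term is an unweighted integral of the
normal derivative. -/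
theorem integral_normSq_sub_profileGrad {a : ℝ} (ha' : a < 1) (lp : ℝ) {D : Set (Pt d)}
    (hD : IsOpen D) (hDb : Bornology.IsBounded D) {G : Pt d → Pt d}
    (hG : MemLp G 2 (weighted a D)) :
    ∫ x, normSq (G x - profileGrad d a lp x) ∂weighted a D =
      (∫ x, normSq (G x) ∂weighted a D) - 2 * lp * (∫ x in upper D, (G x).2) +
        ∫ x, normSq (profileGrad d a lp x) ∂weighted a D := by
  have hi : Integrable (fun x => 2 * dot (G x) (profileGrad d a lp x)) (weighted a D) := by
    refine (((memLp_normal hG).integrable_mul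
      (memLp_profileGrad_snd ha' lp hD hDb)).const_mul 2).congr (Eventually.of_forall fun x => ?_)
    simp [dot, profileGrad]
  have h1 : ∫ x, 2 * dot (G x) (profileGrad d a lp x) ∂weighted a D =
      2 * lp * ∫ x in upper D, (G x).2 := by
    rw [integral_weighted a hD, ← integral_const_mul]
    refine integral_congr_ae ?_
    filter_upwards [ae_restrict_upper hD] with x hx
    have h0 : x.2 ^ a * x.2 ^ (-a) = 1 := by
      rw [← Real.rpow_add hx.2, add_neg_cancel, Real.rpow_zero]
    simp only [dot, profileGrad, inner_zero_right, zero_add]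
    linear_combination (2 * lp * (G x).2) * h0
  have hGi := integrable_normSq hG
  have hPi := integrable_normSq (memLp_profileGrad (d := d) ha' lp hD hDb)
  simp only [normSq_sub]
  have h2 := integral_add (hGi.sub hi) hPi
  simp only [Pi.sub_apply] at h2
  rw [h2, integral_sub hGi hi, h1]

theorem energy_shift {a : ℝ} (ha' : a < 1) (lp : ℝ) {D : Set (Pt d)}
    (hD : IsOpen D) (hDb : Bornology.IsBounded D) {u : Pt d → ℝ} {G : Pt d → Pt d}
    (hG : IsWeakGrad (upper D) u G) (hG2 : MemLp G 2 (weighted a D)) :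
    energy a D (shift a lp u) = ENNReal.ofReal ((∫ x, normSq (G x) ∂weighted a D) -
      2 * lp * (∫ x in upper D, (G x).2) +
        ∫ x, normSq (profileGrad d a lp x) ∂weighted a D) := by
  rw [← integral_normSq_sub_profileGrad ha' lp hD hDb hG2]
  exact energy_eq_ofReal hD
    (hG.sub (isWeakGrad_profile ha' lp (isOpen_upper hD) fun _ hx => hx.2))
    (hG2.sub (memLp_profileGrad ha' lp hD hDb))

/-- Thin values are unique, so every trace `S` agrees a.e. with `T`; nonnegativity removes the `lm`
term. -/
theorem thinEnergy_eq {lp lm : ℝ} {D : Set (Pt d)} (hD : IsOpen D) {u : Pt d → ℝ}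
    (hu : AEMeasurable u (volume.restrict (upper D))) {T : EuclideanSpace ℝ (Fin d) → ℝ}
    (hT : IsThinTrace D u T) (hpos : ∀ᵐ x' ∂volume.restrict (thin D), 0 ≤ T x') :
    thinEnergy lp lm D u = ∫⁻ x' in thin D, ENNReal.ofReal (lp * T x') := by
  have h : ∀ S, IsThinTrace D u S →
      ∫⁻ x' in thin D, ENNReal.ofReal (lp * max (S x') 0 + lm * max (- S x') 0) =
        ∫⁻ x' in thin D, ENNReal.ofReal (lp * T x') := by
    intro S hS
    refine lintegral_congr_ae ?_
    filter_upwards [hS.2, hT.2, hpos, ae_restrict_mem (isOpen_thin hD).measurableSet]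
      with x' h1 h2 h3 h4
    rw [h1.unique h2 (eventually_aemeasurable_halfCyl hD hu h4), max_eq_left h3,
      max_eq_right (neg_nonpos.2 h3), mul_zero, add_zero]
  exact le_antisymm ((iInf₂_le T hT).trans (h T hT).le) (le_iInf₂ fun S hS => (h S hS).ge)

/-- A function with nonnegative thin values has a nonnegative trace. -/
theorem ThinGE.exists_isThinTrace {D : Set (Pt d)} (hD : IsOpen D) {u : Pt d → ℝ}
    (hu : IntegrableOn u (upper D)) (h : ThinGE D u fun _ => 0) :
    ∃ T, IsThinTrace D u T ∧ ∀ᵐ x' ∂volume.restrict (thin D), 0 ≤ T x' := by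
  -- The default value `0` is used only on a null set of `D'` and off `D'`.
  have h' : ∀ x', ∃ t : ℝ, (∃ l, HasThinValue u x' l ∧ 0 ≤ l) → HasThinValue u x' t ∧ 0 ≤ t :=
    fun x' => by
      by_cases hx : ∃ l, HasThinValue u x' l ∧ 0 ≤ l
      · exact ⟨hx.choose, fun _ => hx.choose_spec⟩
      · exact ⟨0, fun h => absurd h hx⟩
  choose T hT using h'
  refine ⟨T, isThinTrace_of_hasThinValue hD hu ?_, ?_⟩
  · filter_upwards [h] with x' hx using (hT x' hx).1
  · filter_upwards [h] with x' hx using (hT x' hx).2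

theorem thinEnergy_eq_ofReal {lp lm : ℝ} (hlp : 0 < lp) {D : Set (Pt d)} (hD : IsOpen D)
    {u : Pt d → ℝ} (hu : AEMeasurable u (volume.restrict (upper D)))
    {T : EuclideanSpace ℝ (Fin d) → ℝ} (hT : IsThinTrace D u T)
    (hpos : ∀ᵐ x' ∂volume.restrict (thin D), 0 ≤ T x') (hTi : IntegrableOn T (thin D)) :
    thinEnergy lp lm D u = ENNReal.ofReal (lp * ∫ x' in thin D, T x') := by
  rw [thinEnergy_eq hD hu hT hpos, ← integral_const_mul,
    ofReal_integral_eq_lintegral_ofReal (hTi.const_mul lp)]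
  filter_upwards [hpos] with x' hx using mul_nonneg hlp.le hx

/-- The difference of two functions with the same values on `(∂D)⁺` is approximated by smooth
functions that vanish near `(∂D)⁺`. -/
theorem Admissible.normalApprox_sub {a : ℝ} (ha' : a < 1) {D : Set (Pt d)} (hD : IsOpen D)
    (hDb : Bornology.IsBounded D) {g u w : Pt d → ℝ} (hu : Admissible a D g u)
    (hw : Admissible a D g w) :
    ∃ q, NormalApprox D (fun x => w x - u x) q ∧
      IsWeakDeriv (upper D) (0, 1) (fun x => w x - u x) q := by
  have key : ∀ f, ZeroOnUpperBdry a D f → ∃ q, NormalApprox D f q ∧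
      IsWeakDeriv (upper D) (0, 1) f q := fun f hf => by
    obtain ⟨-, G, hG, -⟩ := hf.1
    exact ⟨_, fun ε hε => hf.exists_approx ha' hD hDb (hG.isWeakDeriv _) hε, hG.isWeakDeriv _⟩
  obtain ⟨p, hp, hp'⟩ := key _ hw.2
  obtain ⟨q, hq, hq'⟩ := key _ hu.2
  have h1 := hp.sub hq (aemeasurable_of_locallyIntegrableOn hp'.1)
    (aemeasurable_of_locallyIntegrableOn hp'.2.1)
  have h2 := hp'.sub hq'
  simp only [sub_sub_sub_cancel_right] at h1 h2
  exact ⟨_, h1, h2⟩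

/-- If two functions agree on `(∂D)⁺` then the difference of the integrals of their normal
derivatives is given by their traces. -/
theorem Admissible.integral_trace_sub {a : ℝ} (ha' : a < 1) {D : Set (Pt d)} (hD : IsOpen D)
    (hDb : Bornology.IsBounded D)
    (hDn : volume {x' : EuclideanSpace ℝ (Fin d) | (x', (0 : ℝ)) ∈ frontier D} = 0)
    {g u w : Pt d → ℝ} (hu : Admissible a D g u) (hw : Admissible a D g w)
    {G H : Pt d → Pt d} (hG : IsWeakGrad (upper D) u G) (hG2 : MemLp G 2 (weighted a D))
    (hH : IsWeakGrad (upper D) w H) (hH2 : MemLp H 2 (weighted a D))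
    {S T : EuclideanSpace ℝ (Fin d) → ℝ} (hS : IsThinTrace D u S) (hT : IsThinTrace D w T) :
    IntegrableOn (fun x' => T x' - S x') (thin D) ∧ ∫ x' in thin D, (T x' - S x') =
      (∫ x in upper D, (G x).2) - ∫ x in upper D, (H x).2 := by
  have hui := integrableOn_upper_of_memLp ha' hD hDb hu.1.1
  have hwi := integrableOn_upper_of_memLp ha' hD hDb hw.1.1
  have hGi := integrableOn_upper_of_memLp ha' hD hDb (memLp_normal hG2)
  have hHi := integrableOn_upper_of_memLp ha' hD hDb (memLp_normal hH2)
  obtain ⟨q, hq, hq'⟩ := hu.normalApprox_sub ha' hD hDb hw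
  have hd : IsWeakDeriv (upper D) (0, 1) (fun x => w x - u x) fun x => (H x).2 - (G x).2 := by
    simpa only [dot_normal] using (hH.isWeakDeriv (0, 1)).sub (hG.isWeakDeriv (0, 1))
  have hae := hd.ae_eq (isOpen_upper hD) hq'
  have h := hq.integral_trace hD hDb hDn (hwi.sub hui) ((hHi.sub hGi).congr hae)
    (T := fun x' => T x' - S x') (by
      filter_upwards [hS.2, hT.2, ae_restrict_mem (isOpen_thin hD).measurableSet] with x' h1 h2 h3
      exact h2.sub h1 (eventually_aemeasurable_halfCyl hD hui.1.aemeasurable h3))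
  refine ⟨h.1, ?_⟩
  rw [h.2, ← integral_congr_ae hae, integral_sub hHi hGi, neg_sub]

/-- Among functions that are nonnegative on the thin space, the energy of the shifted function and
the functional `J_a` differ by a constant. -/
theorem energy_shift_le_of_functionalJ_le {a lp lm : ℝ} (ha' : a < 1) (hlp : 0 < lp)
    {D : Set (Pt d)} (hD : IsOpen D) (hDb : Bornology.IsBounded D)
    (hDn : volume {x' : EuclideanSpace ℝ (Fin d) | (x', (0 : ℝ)) ∈ frontier D} = 0)
    {g u w : Pt d → ℝ} (hu : Admissible a D g u) (hw : Admissible a D g w)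
    (hu0 : ThinGE D u fun _ => 0) (hw0 : ThinGE D w fun _ => 0)
    (hfin : functionalJ a lp lm D u ≠ ⊤)
    (hle : functionalJ a lp lm D u ≤ functionalJ a lp lm D w) :
    energy a D (shift a lp u) ≤ energy a D (shift a lp w) := by
  have hui := integrableOn_upper_of_memLp ha' hD hDb hu.1.1
  have hwi := integrableOn_upper_of_memLp ha' hD hDb hw.1.1
  obtain ⟨-, G, hG, hG2⟩ := hu.1
  obtain ⟨-, H, hH, hH2⟩ := hw.1
  obtain ⟨S, hS, hS0⟩ := hu0.exists_isThinTrace hD hui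
  obtain ⟨T, hT, hT0⟩ := hw0.exists_isThinTrace hD hwi
  obtain ⟨hTS, htr⟩ := hu.integral_trace_sub ha' hD hDb hDn hw hG hG2 hH hH2 hS hT
  -- Finiteness of `J_a(u)` makes `S` integrable; `T` follows, because `T - S` is integrable by the
  -- trace identity.
  have hSi : IntegrableOn S (thin D) := by
    have h1 : ∫⁻ x' in thin D, ENNReal.ofReal (lp * S x') ≠ ⊤ := fun h => by
      rw [← thinEnergy_eq (lm := lm) hD hui.1.aemeasurable hS hS0] at h
      exact hfin (by rw [functionalJ, h]; simp)
    have h2 : IntegrableOn (fun x' => lp * S x') (thin D) :=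
      ⟨hS.1.const_mul lp, (hasFiniteIntegral_iff_ofReal
        (hS0.mono fun x' hx => mul_nonneg hlp.le hx)).2 h1.lt_top⟩
    exact (h2.const_mul lp⁻¹).congr
      (Eventually.of_forall fun x' => inv_mul_cancel_left₀ hlp.ne' _)
  have hTi : IntegrableOn T (thin D) :=
    (hTS.add hSi).congr (Eventually.of_forall fun x' => sub_add_cancel _ _)
  rw [integral_sub hTi hSi] at htr
  have hGn : 0 ≤ ∫ x, normSq (G x) ∂weighted a D := integral_nonneg fun x => normSq_nonneg _
  have hHn : 0 ≤ ∫ x, normSq (H x) ∂weighted a D := integral_nonneg fun x => normSq_nonneg _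
  have hSn : 0 ≤ lp * ∫ x' in thin D, S x' := mul_nonneg hlp.le (integral_nonneg_of_ae hS0)
  have hTn : 0 ≤ lp * ∫ x' in thin D, T x' := mul_nonneg hlp.le (integral_nonneg_of_ae hT0)
  rw [functionalJ, functionalJ, energy_eq_ofReal hD hG hG2, energy_eq_ofReal hD hH hH2,
    thinEnergy_eq_ofReal hlp hD hui.1.aemeasurable hS hS0 hSi,
    thinEnergy_eq_ofReal hlp hD hwi.1.aemeasurable hT hT0 hTi,
    two_mul, two_mul, ← ENNReal.ofReal_add hSn hSn,
    ← ENNReal.ofReal_add hTn hTn, ← ENNReal.ofReal_add hGn (by positivity),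
    ← ENNReal.ofReal_add hHn (by positivity), ENNReal.ofReal_le_ofReal_iff (by positivity)] at hle
  rw [energy_shift ha' lp hD hDb hG hG2, energy_shift ha' lp hD hDb hH hH2]
  refine ENNReal.ofReal_le_ofReal ?_
  -- The trace identity exchanges the thin integrals in `hle` for the cross terms, and the energy of
  -- the profile cancels.
  linear_combination hle + 2 * lp * htr

end TwoPhaseFrac

end

theorem proposition1p1 (d : ℕ) (a lp lm : ℝ) (ha : -1 < a) (ha' : a < 1) (hlp : 0 < lp)
    (hlm : 0 < lm) (D : Set (TwoPhaseFrac.Pt d)) (hDo : IsOpen D) (hDc : IsConnected D)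
    (hDb : Bornology.IsBounded D)
    (hDn : volume {x' : EuclideanSpace ℝ (Fin d) | (x', (0 : ℝ)) ∈ frontier D} = 0)
    (g u : TwoPhaseFrac.Pt d → ℝ) (hu : TwoPhaseFrac.IsMinimizerJ a lp lm D g u)
    (hpos : TwoPhaseFrac.ThinGE D u (fun _ => 0)) :
    TwoPhaseFrac.IsMinimizerObstacle a D (TwoPhaseFrac.shift a lp g) (fun _ => 0)
        (TwoPhaseFrac.shift a lp u) ∧
      (∀ x' ∈ TwoPhaseFrac.thin D, ∀ l : ℝ, TwoPhaseFrac.HasThinValue u x' l ↔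
        TwoPhaseFrac.HasThinValue (TwoPhaseFrac.shift a lp u) x' l) ∧
      TwoPhaseFrac.gammaPlus D u =
        TwoPhaseFrac.obstacleFreeBdry D (TwoPhaseFrac.shift a lp u) (fun _ => 0) := by
  obtain ⟨hadm, hfin, hmin⟩ := hu
  refine ⟨⟨⟨hadm.shift ha' lp hDo hDb, hpos.shift ha' lp⟩, fun w hw hw0 => ?_⟩,
    fun x' _ l => TwoPhaseFrac.hasThinValue_shift_iff ha' lp u x' l, ?_⟩
  -- Shifting by `-lp` adds the profile back, turning `w` into a competitor for `u`.
  · have hw' : TwoPhaseFrac.Admissible a D g (TwoPhaseFrac.shift a (-lp) w) := by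
      have h := hw.shift ha' (-lp) hDo hDb
      have hg := TwoPhaseFrac.shift_shift_neg a (-lp) g
      rw [neg_neg] at hg
      rwa [hg] at h
    rw [← TwoPhaseFrac.shift_shift_neg a lp w]
    exact TwoPhaseFrac.energy_shift_le_of_functionalJ_le ha' hlp hDo hDb hDn hadm hw' hpos
      (hw0.shift ha' (-lp)) hfin (hmin _ hw')
  -- The positivity sets coincide pointwise, hence so do their frontiers.
  · simp only [TwoPhaseFrac.gammaPlus, TwoPhaseFrac.obstacleFreeBdry,
      TwoPhaseFrac.hasThinValue_shift_iff ha' lp u]
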